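/- Let $n$ be a natural number and let $A,B\in M_n(\mathbb Z)$ be non-singular, with characteristic polynomials $h_A,h_B\in\mathbb Z[t]$. Put $$G_A=\{A^{-k}x \mid x\in\mathbb Z^n,\ k\in\mathbb Z\}\subseteq\mathbb Q^n,$$ and define $G_B$ (and $G_M$ for every non-singular integer matrix $M$) in the same way. For a prime $p$ let $t_p(A)$ be the multiplicity of $0$ as a root of $h_A \bmod p$, and let $\mathcal P'(A)$ be the set of primes $p$ with $p\mid\det A$ and $h_A\not\equiv t^n \pmod p$. An isomorphism from $G_A$ to $G_B$ is a matrix $T\in GL_n(\mathbb Q)$ with $T(G_A)=G_B$. It is called reducible if there are $S,L\in GL_n(\mathbb Z)$ and non-constant $f,g,f',g'\in\mathbb Z[t]$ with $h_A=fg$, $h_B=f'g'$, $\deg f=\deg f'$, such that $$SAS^{-1}=\begin{pmatrix}A'&*\\0&A''\end{pmatrix},\qquad LBL^{-1}=\begin{pmatrix}B'&*\\0&B''\end{pmatrix}$$ with integer blocks, $h_{A'}=f$, $h_{B'}=f'$, and $LTS^{-1}(G_{A'})=G_{B'}$, where $G_{A'}$ and $G_{B'}$ are regarded as subsets of $\mathbb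 Q^n$ via $x\mapsto(x,0)$. Otherwise it is called irreducible. Assume that there is a prime $p\in\mathcal P'(A)$ with $\gcd(n,t_p(A))=1$, and let $T\in GL_n(\mathbb Q)$ be an irreducible isomorphism from $G_A$ to $G_B$. Then: 1. $h_A$ and $h_B$ are both irreducible in $\mathbb Z[t]$; 2. there are eigenvalues $\lambda,\mu\in\overline{\mathbb Q}$ of $A$ and $B$, respectively, such that $\mathbb Q(\lambda)=\mathbb Q(\mu)$ and, writing $K$ for this field and $\mathcal O_K$ for its ring of integers, $\lambda$ and $\mu$ have the same prime ideal divisors in $\mathcal O_K$ (the same non-zero prime ideals of $\mathcal O_K$ divide $\lambda\mathcal O_K$ and $\mu\mathcal O_K$); 3. for every eigenvector $u\in\overline{\mathbb Q}^{\,n}$ of $A$, $T(u)$ is an eigenvector of $B$. -/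

import Mathlib

namespace ToroidalSolenoid

open Polynomial

/-- The fixed algebraic closure of `ℚ`. -/
abbrev QBar : Type := AlgebraicClosure ℚ

/-- The group `G_A = { A⁻ᵏ x | x ∈ ℤⁿ, k ∈ ℤ } ⊆ ℚⁿ` of a non-singular integer matrix `A`. -/
def G {ι : Type*} [Fintype ι] [DecidableEq ι] (A : Matrix ι ι ℤ) : Set (ι → ℚ) :=
  {v | ∃ (k : ℤ) (x : ι → ℤ),
    v = Matrix.mulVec ((A.map (Int.castRingHom ℚ)) ^ (-k)) (fun i => (x i : ℚ))}

/-- `T ∈ GL_n(ℚ)` is an isomorphism from `G_A` to `G_B`, that is, `T(G_A) = G_B`. -/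
def IsIso {n : ℕ} (A B : Matrix (Fin n) (Fin n) ℤ)
    (T : Matrix.GeneralLinearGroup (Fin n) ℚ) : Prop :=
  Matrix.mulVec (T : Matrix (Fin n) (Fin n) ℚ) '' G A = G B

/-- The reduction modulo `p` of the characteristic polynomial `h_A`. -/
noncomputable def charpolyMod {n : ℕ} (p : ℕ) (A : Matrix (Fin n) (Fin n) ℤ) : (ZMod p)[X] :=
  A.charpoly.map (Int.castRingHom (ZMod p))

/-- `t_p(A)`: the multiplicity of zero in the reduction of `h_A` modulo `p`. -/
noncomputable def t {n : ℕ} (p : ℕ) (A : Matrix (Fin n) (Fin n) ℤ) : ℕ :=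
  (charpolyMod p A).rootMultiplicity 0

/-- `𝒫(A)`: the set of prime divisors of `det A`. -/
def P {n : ℕ} (A : Matrix (Fin n) (Fin n) ℤ) : Set ℕ :=
  {p | p.Prime ∧ (p : ℤ) ∣ A.det}

/-- `𝒫'(A)`: the set of primes `p ∈ 𝒫(A)` with `h_A ≢ xⁿ (mod p)`. -/
def P' {n : ℕ} (A : Matrix (Fin n) (Fin n) ℤ) : Set ℕ :=
  {p | p ∈ P A ∧ charpolyMod p A ≠ X ^ n}

/-- The order-preserving splitting of `n = m + k` indices into the first `m` and the last `k`. -/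
def splitIndex {m k n : ℕ} (h : m + k = n) : Fin m ⊕ Fin k ≃ Fin n :=
  finSumFinEquiv.trans (finCongr h)

/-- The block upper triangular matrix with diagonal blocks `A'`, `A''` and corner `X`. -/
def blockTriangular {m k n : ℕ} (h : m + k = n) (A' : Matrix (Fin m) (Fin m) ℤ)
    (X : Matrix (Fin m) (Fin k) ℤ) (A'' : Matrix (Fin k) (Fin k) ℤ) :
    Matrix (Fin n) (Fin n) ℤ :=
  Matrix.reindex (splitIndex h) (splitIndex h) (Matrix.fromBlocks A' X 0 A'')

/-- The embedding `x ↦ (x, 0)` of `ℚᵐ` into `ℚⁿ`, for `n = m + k`. -/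
def firstBlock {m k n : ℕ} (h : m + k = n) (x : Fin m → ℚ) : Fin n → ℚ :=
  fun i => Sum.elim x (fun _ => 0) ((splitIndex h).symm i)

/-- An isomorphism `T : G_A → G_B` is reducible if `h_A = f g`, `h_B = f' g'` with all four
factors non-constant, `deg f = deg f'`, and for some `S, L ∈ GL_n(ℤ)` the matrices `S A S⁻¹` and
`L B L⁻¹` are block upper triangular with first diagonal blocks `A'`, `B'` of characteristic
polynomials `f`, `f'`, and `L T S⁻¹` maps `G_{A'}` onto `G_{B'}`, these being embedded in `ℚⁿ` by
`x ↦ (x, 0)`. (The blocks `A'`, `B'` have the same size `m = deg f = deg f'`.) -/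
def IsReducible {n : ℕ} (A B : Matrix (Fin n) (Fin n) ℤ)
    (T : Matrix.GeneralLinearGroup (Fin n) ℚ) : Prop :=
  ∃ (S L : Matrix.GeneralLinearGroup (Fin n) ℤ) (f g f' g' : ℤ[X]),
    0 < f.natDegree ∧ 0 < g.natDegree ∧ 0 < f'.natDegree ∧ 0 < g'.natDegree ∧
    A.charpoly = f * g ∧ B.charpoly = f' * g' ∧ f.natDegree = f'.natDegree ∧
    ∃ (m k : ℕ) (h : m + k = n)
      (A' B' : Matrix (Fin m) (Fin m) ℤ) (X Y : Matrix (Fin m) (Fin k) ℤ)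
      (A'' B'' : Matrix (Fin k) (Fin k) ℤ),
      (S : Matrix (Fin n) (Fin n) ℤ) * A * ((S⁻¹ : Matrix.GeneralLinearGroup (Fin n) ℤ) :
        Matrix (Fin n) (Fin n) ℤ) = blockTriangular h A' X A'' ∧
      (L : Matrix (Fin n) (Fin n) ℤ) * B * ((L⁻¹ : Matrix.GeneralLinearGroup (Fin n) ℤ) :
        Matrix (Fin n) (Fin n) ℤ) = blockTriangular h B' Y B'' ∧
      A'.charpoly = f ∧ B'.charpoly = f' ∧
      Matrix.mulVec ((Matrix.GeneralLinearGroup.map (Int.castRingHom ℚ) L * T *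
          (Matrix.GeneralLinearGroup.map (Int.castRingHom ℚ) S)⁻¹ :
          Matrix.GeneralLinearGroup (Fin n) ℚ) : Matrix (Fin n) (Fin n) ℚ) ''
        (firstBlock h '' G A') = firstBlock h '' G B'

/-- `T` is an irreducible isomorphism from `G_A` to `G_B`. -/
def IsIrreducibleIso {n : ℕ} (A B : Matrix (Fin n) (Fin n) ℤ)
    (T : Matrix.GeneralLinearGroup (Fin n) ℚ) : Prop :=
  IsIso A B T ∧ ¬ IsReducible A B T

/-- The linear endomorphism of `Q̄ⁿ` given by an integer matrix. -/
noncomputable def toEnd {n : ℕ} (A : Matrix (Fin n) (Fin n) ℤ) :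
    Module.End QBar (Fin n → QBar) :=
  Matrix.toLin' (A.map (Int.castRingHom QBar))

/-- `a` and `b` have the same prime ideal divisors in the ring `R`. -/
def SamePrimeIdealDivisors {R : Type*} [CommRing R] (a b : R) : Prop :=
  ∀ I : Ideal R, I.IsPrime → I ≠ ⊥ → (I ∣ Ideal.span {a} ↔ I ∣ Ideal.span {b})

end ToroidalSolenoid

/-! Put `C = T⁻¹BT` (`pullback`). A proper non-zero rational subspace invariant under `A` and `C`
can be straightened by elements of `GL_n(ℤ)`, which makes `T` reducible
(`isReducible_of_invariant`). So irreducibility of `T` says that `A` and `C` act irreducibly on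
`ℚⁿ`, and the heart of the proof is that they commute.

Fix a valuation of `Q̄` above `p` and let `D` be the space of vectors whose iterates under `A` tend
to zero. It is the sum of the generalized eigenspaces for the eigenvalues of valuation less than
one, so its dimension is `t_p(A)` (`finrank_contracted`). Since `T` is integral up to powers of `A`
and `B`, it carries `D` into the analogous space of `B`, and `T⁻¹` carries it back; hence `D` is
also `C`-invariant. Let `d` be the least dimension of a non-zero common invariant subspace over
`Q̄`. The sum of those of dimension `d` is Galois-stable, so by descent and irreducibility it is
everything, and `d` divides the dimension of every common invariant subspace. Thus `d` divides both
`n` and `t_p(A)`, so `d = 1`: common eigenvectors span and `AC = CA` (`commute_of_coprime_finrank`).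

By Schur's lemma a polynomial in `A` or in `C` is zero or invertible, so each characteristic
polynomial is a power `q ^ r` of an irreducible. Then `r` divides `n` and `t_p(A) = t_p(B)`, whence
`r = 1`. The spectrum is now simple, so every eigenvector of `A` is one of `C`, and `T` maps it to
an eigenvector of `B`. Matched left eigenvectors over `ℚ(λ)` give the eigenvalues of the second
claim, and Krull's intersection theorem compares their primes (`mem_prime_of_mem_prime`). -/

namespace ToroidalSolenoid

open Polynomial

/-! ### Integer matrices over `ℚ` and the groups `G_A` -/

section Rational

variable {ι : Type*}

/-- The rational matrix with the entries of an integer matrix. -/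
abbrev toRat {κ : Type*} (A : Matrix ι κ ℤ) : Matrix ι κ ℚ := A.map (Int.castRingHom ℚ)

/-- The rational vector with the entries of an integer vector. -/
abbrev ratVec (x : ι → ℤ) : ι → ℚ := fun i => (x i : ℚ)

lemma toRat_mul [Fintype ι] (A B : Matrix ι ι ℤ) : toRat (A * B) = toRat A * toRat B :=
  Matrix.map_mul

lemma toRat_one [DecidableEq ι] : toRat (1 : Matrix ι ι ℤ) = 1 := by
  simp [toRat]

@[simp] lemma ratVec_apply (x : ι → ℤ) (i : ι) : ratVec x i = x i := rfl

lemma toRat_mulVec [Fintype ι] (A : Matrix ι ι ℤ) (x : ι → ℤ) :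
    Matrix.mulVec (toRat A) (ratVec x) = ratVec (Matrix.mulVec A x) := by
  ext i
  simp [Matrix.mulVec, dotProduct]

variable [Fintype ι]

lemma exists_natCast_smul_eq_ratVec [DecidableEq ι] (v : ι → ℚ) :
    ∃ (d : ℕ) (x : ι → ℤ), d ≠ 0 ∧ (d : ℚ) • v = ratVec x := by
  refine ⟨∏ i, (v i).den, fun i => (v i).num * ∏ j ∈ Finset.univ.erase i, ((v j).den : ℤ),
    Finset.prod_ne_zero_iff.2 fun i _ => (v i).den_nz, ?_⟩
  ext i
  have h : (v i) * (v i).den = (v i).num := Rat.mul_den_eq_num _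
  simp only [Pi.smul_apply, smul_eq_mul, ratVec_apply]
  rw [← Finset.mul_prod_erase Finset.univ _ (Finset.mem_univ i)]
  push_cast
  rw [← h]
  ring

variable [DecidableEq ι]

lemma toRat_pow (A : Matrix ι ι ℤ) (k : ℕ) : toRat (A ^ k) = toRat A ^ k :=
  Matrix.map_pow A (Int.castRingHom ℚ) k

lemma isUnit_det_toRat {A : Matrix ι ι ℤ} (hA : A.det ≠ 0) : IsUnit (toRat A).det := by
  have h : (toRat A).det = (A.det : ℚ) := ((Int.castRingHom ℚ).map_det A).symm
  rw [h, isUnit_iff_ne_zero]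
  exact_mod_cast hA

/-- Membership in `G_A`: some power of `A` carries the vector into `ℤⁿ`. -/
lemma mem_G_iff {A : Matrix ι ι ℤ} (hA : A.det ≠ 0) (v : ι → ℚ) :
    v ∈ G A ↔ ∃ (k : ℕ) (x : ι → ℤ), Matrix.mulVec (toRat A ^ k) v = ratVec x := by
  have hu := isUnit_det_toRat hA
  constructor
  · rintro ⟨k, x, rfl⟩
    obtain ⟨j, rfl | rfl⟩ := k.eq_nat_or_neg
    · refine ⟨j, x, ?_⟩
      rw [Matrix.mulVec_mulVec, Matrix.zpow_neg_natCast, Matrix.mul_nonsing_inv, Matrix.one_mulVec]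
      rw [Matrix.det_pow]
      exact hu.pow j
    · refine ⟨0, Matrix.mulVec (A ^ j) x, ?_⟩
      rw [← toRat_mulVec, toRat_pow, neg_neg, zpow_natCast, pow_zero, Matrix.one_mulVec]
  · rintro ⟨k, x, h⟩
    refine ⟨k, x, ?_⟩
    change v = Matrix.mulVec _ (ratVec x)
    rw [← h, Matrix.mulVec_mulVec, Matrix.zpow_neg_natCast, Matrix.nonsing_inv_mul,
      Matrix.one_mulVec]
    rw [Matrix.det_pow]
    exact hu.pow k

end Rational

/-! ### Block triangular matrices and coordinate subspaces -/

section Split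

variable {m k n : ℕ} (h : m + k = n)

@[simp] lemma firstBlock_inl (x : Fin m → ℚ) (i : Fin m) :
    firstBlock h x (splitIndex h (Sum.inl i)) = x i := by
  simp [firstBlock]

@[simp] lemma firstBlock_inr (x : Fin m → ℚ) (j : Fin k) :
    firstBlock h x (splitIndex h (Sum.inr j)) = 0 := by
  simp [firstBlock]

lemma firstBlock_injective : Function.Injective (firstBlock h) := by
  intro x y hxy
  ext i
  simpa using congrFun hxy (splitIndex h (Sum.inl i))

lemma funext_splitIndex {α : Type*} {x y : Fin n → α}
    (h₁ : ∀ i, x (splitIndex h (Sum.inl i)) = y (splitIndex h (Sum.inl i)))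
    (h₂ : ∀ j, x (splitIndex h (Sum.inr j)) = y (splitIndex h (Sum.inr j))) : x = y := by
  ext l
  obtain ⟨l, rfl⟩ := (splitIndex h).surjective l
  rcases l with i | j
  exacts [h₁ i, h₂ j]

/-- `firstBlock` as a linear map. -/
def firstBlockLin : (Fin m → ℚ) →ₗ[ℚ] (Fin n → ℚ) where
  toFun := firstBlock h
  map_add' x y := funext_splitIndex h (by simp) (by simp)
  map_smul' x y := funext_splitIndex h (by simp) (by simp)

lemma mem_range_firstBlock_iff (v : Fin n → ℚ) :
    v ∈ Set.range (firstBlock h) ↔ ∀ j : Fin k, v (splitIndex h (Sum.inr j)) = 0 := by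
  constructor
  · rintro ⟨x, rfl⟩ j
    simp
  · intro hv
    exact ⟨fun i => v (splitIndex h (Sum.inl i)),
      funext_splitIndex h (by simp) (fun j => by simp [hv j])⟩

lemma toRat_blockTriangular_mulVec (A' : Matrix (Fin m) (Fin m) ℤ) (X : Matrix (Fin m) (Fin k) ℤ)
    (A'' : Matrix (Fin k) (Fin k) ℤ) (x : Fin m → ℚ) :
    Matrix.mulVec (toRat (blockTriangular h A' X A'')) (firstBlock h x) =
      firstBlock h (Matrix.mulVec (toRat A') x) := by
  refine funext_splitIndex h (fun i => ?_) (fun j => ?_) <;>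
  · simp only [Matrix.mulVec, dotProduct, firstBlock_inl, firstBlock_inr]
    rw [← Equiv.sum_comp (splitIndex h)]
    simp [blockTriangular]

lemma toRat_blockTriangular_pow_mulVec (A' : Matrix (Fin m) (Fin m) ℤ)
    (X : Matrix (Fin m) (Fin k) ℤ) (A'' : Matrix (Fin k) (Fin k) ℤ) (x : Fin m → ℚ) (l : ℕ) :
    Matrix.mulVec (toRat (blockTriangular h A' X A'') ^ l) (firstBlock h x) =
      firstBlock h (Matrix.mulVec (toRat A' ^ l) x) := by
  induction l with
  | zero => simp
  | succ l ih =>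
    rw [pow_succ', ← Matrix.mulVec_mulVec, ih, toRat_blockTriangular_mulVec, pow_succ',
      ← Matrix.mulVec_mulVec]

lemma firstBlock_ratVec_iff (y : Fin m → ℚ) :
    (∃ x, firstBlock h y = ratVec x) ↔ ∃ z, y = ratVec z := by
  constructor
  · rintro ⟨x, hx⟩
    refine ⟨fun i => x (splitIndex h (Sum.inl i)), ?_⟩
    ext i
    simpa using congrFun hx (splitIndex h (Sum.inl i))
  · rintro ⟨z, rfl⟩
    refine ⟨fun i => Sum.elim z 0 ((splitIndex h).symm i), ?_⟩
    refine funext_splitIndex h (fun i => ?_) (fun j => ?_) <;> simp [ratVec]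

lemma charpoly_blockTriangular (A' : Matrix (Fin m) (Fin m) ℤ) (X : Matrix (Fin m) (Fin k) ℤ)
    (A'' : Matrix (Fin k) (Fin k) ℤ) :
    (blockTriangular h A' X A'').charpoly = A'.charpoly * A''.charpoly := by
  rw [blockTriangular, Matrix.charpoly_reindex, Matrix.charpoly_fromBlocks_zero₂₁]

lemma det_blockTriangular (A' : Matrix (Fin m) (Fin m) ℤ) (X : Matrix (Fin m) (Fin k) ℤ)
    (A'' : Matrix (Fin k) (Fin k) ℤ) :
    (blockTriangular h A' X A'').det = A'.det * A''.det := by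
  rw [blockTriangular, Matrix.det_reindex_self, Matrix.det_fromBlocks_zero₂₁]

lemma exists_eq_blockTriangular (N : Matrix (Fin n) (Fin n) ℤ)
    (hN : ∀ i j, N (splitIndex h (Sum.inr j)) (splitIndex h (Sum.inl i)) = 0) :
    ∃ A' X A'', N = blockTriangular h A' X A'' := by
  refine ⟨Matrix.of fun i j => N (splitIndex h (Sum.inl i)) (splitIndex h (Sum.inl j)),
    Matrix.of fun i j => N (splitIndex h (Sum.inl i)) (splitIndex h (Sum.inr j)),
    Matrix.of fun i j => N (splitIndex h (Sum.inr i)) (splitIndex h (Sum.inr j)), ?_⟩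
  ext a b
  obtain ⟨a, rfl⟩ := (splitIndex h).surjective a
  obtain ⟨b, rfl⟩ := (splitIndex h).surjective b
  rcases a with a | a <;> rcases b with b | b <;> simp [blockTriangular, hN]

end Split

/-! ### Invariant rational subspaces and reducibility -/

lemma coe_map_GL {n : ℕ} (S : Matrix.GeneralLinearGroup (Fin n) ℤ) :
    ((Matrix.GeneralLinearGroup.map (Int.castRingHom ℚ) S : Matrix.GeneralLinearGroup (Fin n) ℚ) :
      Matrix (Fin n) (Fin n) ℚ) = toRat (S : Matrix (Fin n) (Fin n) ℤ) := rfl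

lemma toRat_GL_mul_inv {n : ℕ} (S : Matrix.GeneralLinearGroup (Fin n) ℤ) :
    toRat (S : Matrix (Fin n) (Fin n) ℤ) *
      toRat ((S⁻¹ : Matrix.GeneralLinearGroup (Fin n) ℤ) : Matrix (Fin n) (Fin n) ℤ) = 1 := by
  rw [← toRat_mul, ← Units.val_mul, mul_inv_cancel, Units.val_one, toRat_one]

lemma toRat_GL_inv_mul {n : ℕ} (S : Matrix.GeneralLinearGroup (Fin n) ℤ) :
    toRat ((S⁻¹ : Matrix.GeneralLinearGroup (Fin n) ℤ) : Matrix (Fin n) (Fin n) ℤ) *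
      toRat (S : Matrix (Fin n) (Fin n) ℤ) = 1 := by
  rw [← toRat_mul, ← Units.val_mul, inv_mul_cancel, Units.val_one, toRat_one]

/-- A rational subspace is moved to a coordinate subspace by an element of `GL_n(ℤ)`. -/
lemma exists_GL_straightening {n : ℕ} (V : Submodule ℚ (Fin n → ℚ)) :
    ∃ (m k : ℕ) (h : m + k = n) (S : Matrix.GeneralLinearGroup (Fin n) ℤ),
      m = Module.finrank ℚ V ∧ ∀ v, v ∈ V ↔
        Matrix.mulVec (toRat (S : Matrix (Fin n) (Fin n) ℤ)) v ∈ Set.range (firstBlock h) := by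
  let c : (Fin n → ℤ) →ₗ[ℤ] (Fin n → ℚ) :=
    { toFun := ratVec
      map_add' := fun x y => by ext; simp [ratVec]
      map_smul' := fun x y => by ext; simp [ratVec] }
  let N : Submodule ℤ (Fin n → ℤ) := (V.restrictScalars ℤ).comap c
  have hmem : ∀ x, x ∈ N ↔ ratVec x ∈ V := fun x => Iff.rfl
  -- The lattice `N = V ∩ ℤⁿ` is saturated because `V` is a rational subspace. The quotient is
  -- therefore free, and a basis of `N` extends to a basis of `ℤⁿ`; the coordinates in that basis
  -- define `S`.
  have htf : Module.IsTorsionFree ℤ ((Fin n → ℤ) ⧸ N) := by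
    refine Module.IsTorsionFree.of_smul_eq_zero fun r q h => ?_
    obtain ⟨x, rfl⟩ := N.mkQ_surjective q
    rw [← map_smul, ← LinearMap.mem_ker, Submodule.ker_mkQ, hmem] at h
    refine or_iff_not_imp_left.2 fun hr => ?_
    rw [← LinearMap.mem_ker, Submodule.ker_mkQ, hmem,
      ← V.smul_mem_iff (show (r : ℚ) ≠ 0 by exact_mod_cast hr)]
    convert! h using 1
    ext
    simp [ratVec]
  let bN := Module.finBasis ℤ N
  let bQ := Module.finBasis ℤ ((Fin n → ℤ) ⧸ N)
  let b := bN.sumQuot bQ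
  have hmk : Module.finrank ℤ N + Module.finrank ℤ ((Fin n → ℤ) ⧸ N) = n := by
    have := Module.finrank_eq_card_basis b
    simpa using this.symm
  let b' : Module.Basis (Fin n) ℤ (Fin n → ℤ) := b.reindex (splitIndex hmk)
  let e : (Fin n → ℤ) ≃ₗ[ℤ] (Fin n → ℤ) := b'.equivFun
  let S : Matrix.GeneralLinearGroup (Fin n) ℤ :=
    ⟨LinearMap.toMatrix' e.toLinearMap, LinearMap.toMatrix' e.symm.toLinearMap,
      by rw [← LinearMap.toMatrix'_comp]; simp,
      by rw [← LinearMap.toMatrix'_comp]; simp⟩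
  have hS : ∀ x, Matrix.mulVec (S : Matrix (Fin n) (Fin n) ℤ) x = e x := fun x => by
    change Matrix.mulVec (LinearMap.toMatrix' e.toLinearMap) x = _
    rw [LinearMap.toMatrix'_mulVec]; rfl
  have hN : ∀ x, x ∈ N ↔ ∀ j, e x (splitIndex hmk (Sum.inr j)) = 0 := by
    intro x
    have h : ∀ j, e x (splitIndex hmk (Sum.inr j)) = bQ.repr (N.mkQ x) j := fun j => by
      simp [e, b', b]
    simp_rw [h]
    have h' : x ∈ N ↔ bQ.repr (N.mkQ x) = 0 := by
      rw [LinearEquiv.map_eq_zero_iff, Submodule.mkQ_apply, Submodule.Quotient.mk_eq_zero]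
    rw [h', Finsupp.ext_iff]
    rfl
  -- Clearing denominators reduces membership in `V` to membership in `N`.
  have hV : ∀ v, v ∈ V ↔ Matrix.mulVec (toRat (S : Matrix (Fin n) (Fin n) ℤ)) v ∈
      Set.range (firstBlock hmk) := by
    intro v
    obtain ⟨d, x, hd, hx⟩ := exists_natCast_smul_eq_ratVec v
    have hd' : (d : ℚ) ≠ 0 := by exact_mod_cast hd
    rw [← V.smul_mem_iff hd', hx, ← hmem, hN, mem_range_firstBlock_iff]
    refine forall_congr' fun j => ?_
    have := congrFun (toRat_mulVec (S : Matrix (Fin n) (Fin n) ℤ) x) (splitIndex hmk (Sum.inr j))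
    rw [← hx, Matrix.mulVec_smul, hS, Pi.smul_apply, smul_eq_mul, ratVec_apply] at this
    constructor
    · intro h0
      simpa [h0, hd] using this
    · intro h0
      rw [h0, mul_zero] at this
      exact_mod_cast this.symm
  refine ⟨_, _, hmk, S, ?_, hV⟩
  let Si := toRat ((S⁻¹ : Matrix.GeneralLinearGroup (Fin n) ℤ) : Matrix (Fin n) (Fin n) ℤ)
  let f : (Fin (Module.finrank ℤ N) → ℚ) →ₗ[ℚ] (Fin n → ℚ) :=
    (Matrix.mulVecLin Si).comp (firstBlockLin hmk)
  have hf : ∀ x, f x = Matrix.mulVec Si (firstBlock hmk x) := fun x => rfl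
  have hfi : Function.Injective f := by
    intro x y hxy
    apply firstBlock_injective hmk
    have := congrArg (Matrix.mulVec (toRat (S : Matrix (Fin n) (Fin n) ℤ))) hxy
    simpa only [hf, Matrix.mulVec_mulVec, Si, toRat_GL_mul_inv, Matrix.one_mulVec] using this
  have hr : LinearMap.range f = V := by
    ext v
    rw [hV]
    constructor
    · rintro ⟨x, rfl⟩
      refine ⟨x, ?_⟩
      simp only [hf, Matrix.mulVec_mulVec, Si, toRat_GL_mul_inv, Matrix.one_mulVec]
    · rintro ⟨x, hx⟩
      refine ⟨x, ?_⟩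
      rw [hf, hx, Matrix.mulVec_mulVec, toRat_GL_inv_mul, Matrix.one_mulVec]
  rw [← hr, LinearMap.finrank_range_of_inj hfi, Module.finrank_fin_fun]

/-- An invariant rational subspace puts the matrix in block triangular form over `ℤ`. -/
lemma exists_conj_blockTriangular {m k n : ℕ} (h : m + k = n) {A : Matrix (Fin n) (Fin n) ℤ}
    (hA : A.det ≠ 0) {V : Submodule ℚ (Fin n → ℚ)}
    (hV : ∀ v ∈ V, Matrix.mulVec (toRat A) v ∈ V) (S : Matrix.GeneralLinearGroup (Fin n) ℤ)
    (hS : ∀ v, v ∈ V ↔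
      Matrix.mulVec (toRat (S : Matrix (Fin n) (Fin n) ℤ)) v ∈ Set.range (firstBlock h)) :
    ∃ (A' : Matrix (Fin m) (Fin m) ℤ) (X : Matrix (Fin m) (Fin k) ℤ)
      (A'' : Matrix (Fin k) (Fin k) ℤ),
      (S : Matrix (Fin n) (Fin n) ℤ) * A * ((S⁻¹ : Matrix.GeneralLinearGroup (Fin n) ℤ) :
        Matrix (Fin n) (Fin n) ℤ) = blockTriangular h A' X A'' ∧
      ∀ v, v ∈ firstBlock h '' G A' ↔ ∃ w ∈ G A, w ∈ V ∧
        Matrix.mulVec (toRat (S : Matrix (Fin n) (Fin n) ℤ)) w = v := by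
  set SQ := toRat (S : Matrix (Fin n) (Fin n) ℤ) with hSQ
  set Si := ((S⁻¹ : Matrix.GeneralLinearGroup (Fin n) ℤ) : Matrix (Fin n) (Fin n) ℤ) with hSi
  have h₁ : SQ * toRat Si = 1 := toRat_GL_mul_inv S
  have h₂ : toRat Si * SQ = 1 := toRat_GL_inv_mul S
  have hinv : ∀ x, Matrix.mulVec (toRat Si) (firstBlock h x) ∈ V := fun x => by
    rw [hS, Matrix.mulVec_mulVec, h₁, Matrix.one_mulVec]
    exact ⟨x, rfl⟩
  -- The lower left block vanishes because `S⁻¹` sends the first `m` basis vectors into `V`, `A`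
  -- preserves `V`, and `S` sends `V` back to the coordinate subspace.
  obtain ⟨A', X, A'', hN⟩ := exists_eq_blockTriangular h
    ((S : Matrix (Fin n) (Fin n) ℤ) * A * Si) (fun i j => by
      have := (mem_range_firstBlock_iff h _).1
        ((hS _).1 (hV _ (hinv (Pi.single i 1)))) j
      rw [Matrix.mulVec_mulVec, Matrix.mulVec_mulVec, hSQ, ← toRat_mul, ← toRat_mul] at this
      have hs : firstBlock h (Pi.single i 1) = Pi.single (splitIndex h (Sum.inl i)) 1 := by
        refine funext_splitIndex h (fun a => ?_) (fun a => ?_) <;> simp [Pi.single_apply]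
      rw [hs, Matrix.mulVec_single_one] at this
      simpa [toRat] using this)
  have hdet : A'.det ≠ 0 := by
    have : (blockTriangular h A' X A'').det ≠ 0 := by
      rw [← hN, Matrix.det_mul, Matrix.det_mul, mul_right_comm, ← Matrix.det_mul, hSi,
        ← Units.val_mul, mul_inv_cancel]
      simpa using hA
    rw [det_blockTriangular] at this
    exact left_ne_zero_of_mul this
  have hconj : ∀ l, SQ * toRat A ^ l = toRat (blockTriangular h A' X A'') ^ l * SQ := fun l => by
    have : SemiconjBy SQ (toRat A) (toRat (blockTriangular h A' X A'')) := by
      rw [← hN, toRat_mul, toRat_mul, SemiconjBy, Matrix.mul_assoc _ (toRat Si), h₂, Matrix.mul_one]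
    exact this.pow_right l
  refine ⟨A', X, A'', hN, fun v => ⟨?_, ?_⟩⟩
  · rintro ⟨y, hy, rfl⟩
    obtain ⟨l, z, hz⟩ := (mem_G_iff hdet y).1 hy
    refine ⟨Matrix.mulVec (toRat Si) (firstBlock h y), ?_, hinv y, ?_⟩
    · obtain ⟨x, hx⟩ := (firstBlock_ratVec_iff h _).2 ⟨z, hz⟩
      refine (mem_G_iff hA _).2 ⟨l, Matrix.mulVec Si x, ?_⟩
      rw [← toRat_mulVec, ← hx, ← toRat_blockTriangular_pow_mulVec h A' X A'']
      simp only [Matrix.mulVec_mulVec]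
      congr 1
      calc _ = toRat Si * (SQ * toRat A ^ l) * toRat Si := by
            rw [← Matrix.mul_assoc, h₂, Matrix.one_mul]
        _ = _ := by rw [hconj, Matrix.mul_assoc, Matrix.mul_assoc, h₁, Matrix.mul_one]
    · rw [Matrix.mulVec_mulVec, h₁, Matrix.one_mulVec]
  · rintro ⟨w, hw, hwV, rfl⟩
    obtain ⟨y, hy⟩ := (hS w).1 hwV
    obtain ⟨l, x, hx⟩ := (mem_G_iff hA w).1 hw
    refine ⟨y, (mem_G_iff hdet y).2 ⟨l, ?_⟩, hy⟩
    refine (firstBlock_ratVec_iff h _).1 ⟨Matrix.mulVec (S : Matrix (Fin n) (Fin n) ℤ) x, ?_⟩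
    rw [← toRat_blockTriangular_pow_mulVec h A' X A'', hy, ← toRat_mulVec, ← hx,
      Matrix.mulVec_mulVec, Matrix.mulVec_mulVec, hconj]

lemma charpoly_conj_GL {n : ℕ} (S : Matrix.GeneralLinearGroup (Fin n) ℤ)
    (A : Matrix (Fin n) (Fin n) ℤ) :
    ((S : Matrix (Fin n) (Fin n) ℤ) * A * ((S⁻¹ : Matrix.GeneralLinearGroup (Fin n) ℤ) :
        Matrix (Fin n) (Fin n) ℤ)).charpoly = A.charpoly := by
  rw [Matrix.coe_units_inv]
  exact Matrix.charpoly_units_conj S A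

lemma GL_val_mul_inv {n : ℕ} (T : Matrix.GeneralLinearGroup (Fin n) ℚ) :
    (T : Matrix (Fin n) (Fin n) ℚ) * ((T⁻¹ : Matrix.GeneralLinearGroup (Fin n) ℚ) :
      Matrix (Fin n) (Fin n) ℚ) = 1 := by
  rw [← Units.val_mul, mul_inv_cancel, Units.val_one]

lemma GL_val_inv_mul {n : ℕ} (T : Matrix.GeneralLinearGroup (Fin n) ℚ) :
    ((T⁻¹ : Matrix.GeneralLinearGroup (Fin n) ℚ) : Matrix (Fin n) (Fin n) ℚ) *
      (T : Matrix (Fin n) (Fin n) ℚ) = 1 := by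
  rw [← Units.val_mul, inv_mul_cancel, Units.val_one]

/-- A proper non-zero `A`-invariant subspace with `B`-invariant image makes `T` reducible. -/
theorem isReducible_of_invariant {n : ℕ} {A B : Matrix (Fin n) (Fin n) ℤ}
    (hA : A.det ≠ 0) (hB : B.det ≠ 0) {T : Matrix.GeneralLinearGroup (Fin n) ℚ}
    (hT : IsIso A B T) {V : Submodule ℚ (Fin n → ℚ)} (hbot : V ≠ ⊥) (htop : V ≠ ⊤)
    (hVA : ∀ v ∈ V, Matrix.mulVec (toRat A) v ∈ V)
    (hVB : ∀ v ∈ V, Matrix.mulVec (((T⁻¹ : Matrix.GeneralLinearGroup (Fin n) ℚ) :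
      Matrix (Fin n) (Fin n) ℚ) * toRat B * (T : Matrix (Fin n) (Fin n) ℚ)) v ∈ V) :
    IsReducible A B T := by
  set TQ := (T : Matrix (Fin n) (Fin n) ℚ) with hTQ
  set Ti := ((T⁻¹ : Matrix.GeneralLinearGroup (Fin n) ℚ) : Matrix (Fin n) (Fin n) ℚ) with hTi
  have h₁ : TQ * Ti = 1 := GL_val_mul_inv T
  have h₂ : Ti * TQ = 1 := GL_val_inv_mul T
  -- The image `T(V)` is `B`-invariant exactly because `V` is invariant under `T⁻¹BT`; both
  -- subspaces are straightened separately, with blocks of equal size.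
  let W := V.map (Matrix.mulVecLin TQ)
  have hWmem : ∀ v, Matrix.mulVec TQ v ∈ W ↔ v ∈ V := fun v => by
    constructor
    · rintro ⟨u, hu, huv⟩
      have := congrArg (Matrix.mulVec Ti) huv
      simp only [Matrix.mulVecLin_apply, Matrix.mulVec_mulVec, h₂, Matrix.one_mulVec] at this
      exact this ▸ hu
    · exact fun hv => ⟨v, hv, rfl⟩
  have hW : ∀ w ∈ W, Matrix.mulVec (toRat B) w ∈ W := by
    rintro _ ⟨v, hv, rfl⟩
    have := (hWmem _).2 (hVB v hv)
    rwa [Matrix.mulVec_mulVec, ← Matrix.mul_assoc, ← Matrix.mul_assoc, h₁, Matrix.one_mul,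
      ← Matrix.mulVec_mulVec] at this
  have hdim : Module.finrank ℚ W = Module.finrank ℚ V := by
    refine (LinearEquiv.finrank_eq (Submodule.equivMapOfInjective _ (fun u v huv => ?_) V)).symm
    have := congrArg (Matrix.mulVec Ti) huv
    simpa only [Matrix.mulVecLin_apply, Matrix.mulVec_mulVec, h₂, Matrix.one_mulVec] using this
  obtain ⟨m, k, h, S, hm, hS⟩ := exists_GL_straightening V
  obtain ⟨m', k', h', L, hm', hL⟩ := exists_GL_straightening W
  obtain rfl : m = m' := by rw [hm, hm', hdim]
  obtain rfl : k = k' := by omega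
  have hm0 : 0 < m := by
    rw [hm, Module.finrank_pos_iff]
    exact Submodule.nontrivial_iff_ne_bot.2 hbot
  have hk0 : 0 < k := by
    have := Submodule.finrank_lt htop
    rw [← hm, Module.finrank_fin_fun] at this
    omega
  obtain ⟨A', X, A'', hSA, hGA⟩ := exists_conj_blockTriangular h hA hVA S hS
  obtain ⟨B', Y, B'', hLB, hGB⟩ := exists_conj_blockTriangular h hB hW L hL
  refine ⟨S, L, A'.charpoly, A''.charpoly, B'.charpoly, B''.charpoly, ?_, ?_, ?_, ?_, ?_, ?_, ?_,
    m, k, h, A', B', X, Y, A'', B'', hSA, hLB, rfl, rfl, ?_⟩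
  · simpa [Matrix.charpoly_natDegree_eq_dim] using hm0
  · simpa [Matrix.charpoly_natDegree_eq_dim] using hk0
  · simpa [Matrix.charpoly_natDegree_eq_dim] using hm0
  · simpa [Matrix.charpoly_natDegree_eq_dim] using hk0
  · rw [← charpoly_blockTriangular h A' X, ← hSA, charpoly_conj_GL]
  · rw [← charpoly_blockTriangular h B' Y, ← hLB, charpoly_conj_GL]
  · simp [Matrix.charpoly_natDegree_eq_dim]
  have hcomp : ∀ w, Matrix.mulVec ((Matrix.GeneralLinearGroup.map (Int.castRingHom ℚ) L * T *
        (Matrix.GeneralLinearGroup.map (Int.castRingHom ℚ) S)⁻¹ :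
        Matrix.GeneralLinearGroup (Fin n) ℚ) : Matrix (Fin n) (Fin n) ℚ)
      (Matrix.mulVec (toRat (S : Matrix (Fin n) (Fin n) ℤ)) w) =
      Matrix.mulVec (toRat (L : Matrix (Fin n) (Fin n) ℤ)) (Matrix.mulVec TQ w) := fun w => by
    rw [Matrix.mulVec_mulVec, ← coe_map_GL, ← Units.val_mul, inv_mul_cancel_right, Units.val_mul,
      coe_map_GL, Matrix.mulVec_mulVec]
  have hG : ∀ w, Matrix.mulVec TQ w ∈ G B ↔ w ∈ G A := fun w => by
    rw [← hT]
    constructor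
    · rintro ⟨u, hu, huv⟩
      have := congrArg (Matrix.mulVec Ti) huv
      simp only [Matrix.mulVec_mulVec, h₂, Matrix.one_mulVec] at this
      rw [← hTQ] at this
      simp only [h₂, Matrix.one_mulVec] at this
      exact this ▸ hu
    · exact fun hw => ⟨w, hw, rfl⟩
  ext v
  constructor
  · rintro ⟨u, hu, rfl⟩
    obtain ⟨w, hwG, hwV, rfl⟩ := (hGA u).1 hu
    exact (hGB _).2 ⟨Matrix.mulVec TQ w, (hG w).2 hwG, (hWmem w).2 hwV, (hcomp w).symm⟩
  · intro hv
    obtain ⟨w, hwG, ⟨u, hu, rfl⟩, rfl⟩ := (hGB v).1 hv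
    exact ⟨_, (hGA _).2 ⟨u, (hG u).1 hwG, hu, rfl⟩, hcomp u⟩

/-! ### The contracted subspace and its dimension -/

section Contraction

open Filter Topology NNReal

/-- Once `b` stays below `δ`, iterating the recursion gives `a (K + j) ≤ max (c ^ j * a K) δ`. This
is the ultrametric recursion met along a chain of generalized eigenvectors. -/
lemma tendsto_zero_of_le_max {a b : ℕ → ℝ≥0} {c : ℝ≥0} (hc : c < 1)
    (hb : Tendsto b atTop (𝓝 0)) (h : ∀ k, a (k + 1) ≤ max (c * a k) (b k)) :
    Tendsto a atTop (𝓝 0) := by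
  rw [tendsto_order]
  refine ⟨fun x hx => absurd hx not_lt_zero, fun ε hε => ?_⟩
  obtain ⟨δ, hδ, hδε⟩ := exists_between hε
  obtain ⟨K, hK⟩ := eventually_atTop.1 (hb.eventually (gt_mem_nhds hδ))
  have hbound : ∀ j, a (K + j) ≤ max (c ^ j * a K) δ := by
    intro j
    induction j with
    | zero => simp
    | succ j ih =>
      refine (h (K + j)).trans (max_le ?_ ((hK (K + j) (by omega)).le.trans (le_max_right _ _)))
      calc c * a (K + j) ≤ c * max (c ^ j * a K) δ := by gcongr
        _ = max (c ^ (j + 1) * a K) (c * δ) := by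
          rw [mul_max_of_nonneg _ _ zero_le, pow_succ', mul_assoc]
        _ ≤ _ := max_le_max le_rfl (mul_le_of_le_one_left zero_le hc.le)
  have hpow : Tendsto (fun j => c ^ j * a K) atTop (𝓝 0) := by
    simpa using (NNReal.tendsto_pow_atTop_nhds_zero_of_lt_one hc).mul_const (a K)
  obtain ⟨J, hJ⟩ := eventually_atTop.1 (hpow.eventually (gt_mem_nhds hε))
  refine eventually_atTop.2 ⟨K + J, fun k hk => ?_⟩
  obtain ⟨j, rfl⟩ := Nat.exists_eq_add_of_le (show K ≤ k by omega)
  exact (hbound j).trans_lt (max_lt (hJ j (by omega)) hδε)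

variable {L : Type*} [Field L] (v : Valuation L ℝ≥0)

lemma valuation_intCast_le_one (z : ℤ) : v (z : L) ≤ 1 :=
  intCast_mem v.integer z

/-- An integer matrix over a field. -/
abbrev toField (L : Type*) [Field L] {ι κ : Type*} (A : Matrix ι κ ℤ) : Matrix ι κ L :=
  A.map (Int.castRingHom L)

variable {n : ℕ}

lemma valuation_mulVec_le (N : Matrix (Fin n) (Fin n) ℤ) {x : Fin n → L} {c : ℝ≥0}
    (hx : ∀ i, v (x i) ≤ c) (i : Fin n) : v (Matrix.mulVec (toField L N) x i) ≤ c := by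
  rw [Matrix.mulVec, dotProduct]
  refine v.map_sum_le fun j _ => ?_
  rw [v.map_mul]
  exact mul_le_of_le_one_of_le (valuation_intCast_le_one v _) (hx j)

lemma valuation_pow_mulVec_le (N : Matrix (Fin n) (Fin n) ℤ) {x : Fin n → L} {c : ℝ≥0}
    (hx : ∀ i, v (x i) ≤ c) (k : ℕ) (i : Fin n) :
    v (Matrix.mulVec (toField L N ^ k) x i) ≤ c := by
  rw [toField, ← Matrix.map_pow]
  exact valuation_mulVec_le v _ hx i

/-- The subspace of vectors contracted to zero by the iterates of an integer matrix, with respect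
to a valuation. -/
def contracted (A : Matrix (Fin n) (Fin n) ℤ) : Submodule L (Fin n → L) where
  carrier := {x | ∀ i, Tendsto (fun k => v (Matrix.mulVec (toField L A ^ k) x i)) atTop (𝓝 0)}
  zero_mem' i := by simp
  add_mem' {x y} hx hy i := by
    have h := (hx i).max (hy i)
    rw [max_self] at h
    refine tendsto_of_tendsto_of_tendsto_of_le_of_le tendsto_const_nhds h (fun _ => zero_le)
      (fun k => ?_)
    simp only [Matrix.mulVec_add, Pi.add_apply]
    exact v.map_add _ _
  smul_mem' c x hx i := by
    simpa [Matrix.mulVec_smul] using (hx i).const_mul (v c)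

/-- A matrix intertwining `A` and `B` up to powers and integer matrices preserves contraction. -/
lemma mulVec_mem_contracted {A B : Matrix (Fin n) (Fin n) ℤ} {T : Matrix (Fin n) (Fin n) L}
    (hT : ∀ k, ∃ (j : ℕ) (N : Matrix (Fin n) (Fin n) ℤ),
      toField L B ^ j * T = toField L N * toField L A ^ k) {x : Fin n → L}
    (hx : x ∈ contracted v A) : Matrix.mulVec T x ∈ contracted v B := by
  intro i
  rw [tendsto_order]
  refine ⟨fun y hy => absurd hy not_lt_zero, fun ε hε => ?_⟩
  obtain ⟨δ, hδ, hδε⟩ := exists_between hε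
  -- Integer matrices do not increase the maximal valuation of the entries. So once `A ^ k x` is
  -- small, `B ^ (r + j) T x = B ^ r N A ^ k x` is as small for every `r`.
  obtain ⟨k, hk⟩ := (eventually_all.2 fun i => (hx i).eventually (gt_mem_nhds hδ)).exists
  obtain ⟨j, N, hj⟩ := hT k
  refine eventually_atTop.2 ⟨j, fun l hl => lt_of_le_of_lt ?_ hδε⟩
  obtain ⟨r, rfl⟩ := Nat.exists_eq_add_of_le' hl
  rw [pow_add, Matrix.mulVec_mulVec, Matrix.mul_assoc, hj, ← Matrix.mulVec_mulVec,
    ← Matrix.mulVec_mulVec]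
  exact valuation_pow_mulVec_le v B (valuation_mulVec_le v N fun i => (hk i).le) r i

lemma toField_mulVec_mem_contracted {A : Matrix (Fin n) (Fin n) ℤ} {x : Fin n → L}
    (hx : x ∈ contracted v A) : Matrix.mulVec (toField L A) x ∈ contracted v A :=
  mulVec_mem_contracted v (fun k => ⟨k, A, by rw [← pow_succ', pow_succ]⟩) hx

/-- The endomorphism of `Lⁿ` given by an integer matrix. -/
noncomputable abbrev toFieldEnd (L : Type*) [Field L] (A : Matrix (Fin n) (Fin n) ℤ) :
    Module.End L (Fin n → L) := Matrix.toLin' (toField L A)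

lemma charpoly_toFieldEnd (A : Matrix (Fin n) (Fin n) ℤ) :
    (toFieldEnd L A).charpoly = A.charpoly.map (Int.castRingHom L) := by
  rw [Matrix.charpoly_toLin', Matrix.charpoly_map]

lemma valuation_le_one_of_isRoot {f : ℤ[X]} (hf : f.Monic) {x : L}
    (hx : (f.map (Int.castRingHom L)).IsRoot x) : v x ≤ 1 := by
  have hint : IsIntegral ℤ x := ⟨f, hf, by rwa [IsRoot, eval_map] at hx⟩
  exact (Valuation.integer.integers v).mem_of_integral hint.tower_top

/-- Induction on the power of `A - c` that kills `x`: with `y = (A - c) x` already contracted, `A ^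
(k + 1) x = c A ^ k x + A ^ k y`, and `tendsto_zero_of_le_max` applies. -/
lemma maxGenEigenspace_le_contracted (A : Matrix (Fin n) (Fin n) ℤ) {c : L} (hc : v c < 1) :
    (toFieldEnd L A).maxGenEigenspace c ≤ contracted v A := by
  have step : ∀ x, Matrix.mulVec (toField L A) x - c • x ∈ contracted v A →
      x ∈ contracted v A := by
    intro x hx i
    refine tendsto_zero_of_le_max hc (hx i) fun k => ?_
    have : Matrix.mulVec (toField L A ^ (k + 1)) x i =
        c * Matrix.mulVec (toField L A ^ k) x i +
          Matrix.mulVec (toField L A ^ k) (Matrix.mulVec (toField L A) x - c • x) i := by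
      rw [Matrix.mulVec_sub, Matrix.mulVec_mulVec, ← pow_succ, Matrix.mulVec_smul]
      simp
    rw [this, ← v.map_mul]
    exact v.map_add _ _
  intro x hx
  rw [Module.End.mem_maxGenEigenspace] at hx
  obtain ⟨k, hk⟩ := hx
  induction k generalizing x with
  | zero =>
    rw [pow_zero, Module.End.one_apply] at hk
    rw [hk]
    exact zero_mem _
  | succ k ih =>
    apply step
    apply ih
    rw [pow_succ, Module.End.mul_apply] at hk
    simpa using hk

/-- By induction `(A - c) x` vanishes, so `x` is zero or an eigenvector; then `v (c ^ l * x i) ≥ v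
(x i)`, which can tend to zero only if `x i = 0`. -/
lemma contracted_inf_maxGenEigenspace (A : Matrix (Fin n) (Fin n) ℤ) {c : L} (hc : ¬ v c < 1) :
    contracted v A ⊓ (toFieldEnd L A).maxGenEigenspace c = ⊥ := by
  rw [Submodule.eq_bot_iff]
  rintro x ⟨hx, hxc⟩
  rw [SetLike.mem_coe, Module.End.mem_maxGenEigenspace] at hxc
  obtain ⟨k, hk⟩ := hxc
  induction k generalizing x with
  | zero => simpa using hk
  | succ k ih =>
    have hy : Matrix.mulVec (toField L A) x - c • x = 0 := by
      apply ih
      · exact sub_mem (toField_mulVec_mem_contracted v hx) (Submodule.smul_mem _ _ hx)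
      · rw [pow_succ, Module.End.mul_apply] at hk
        simpa using hk
    have hpow : ∀ l, Matrix.mulVec (toField L A ^ l) x = c ^ l • x := by
      intro l
      induction l with
      | zero => simp
      | succ l ihl =>
        rw [pow_succ, ← Matrix.mulVec_mulVec, sub_eq_zero.1 hy, Matrix.mulVec_smul, ihl, smul_smul,
          pow_succ']
    ext i
    have hlim := hx i
    simp only [hpow, Pi.smul_apply, smul_eq_mul, map_mul, map_pow] at hlim
    have : v (x i) ≤ 0 := ge_of_tendsto' hlim fun l =>
      le_mul_of_one_le_left zero_le (one_le_pow₀ (not_lt.1 hc))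
    simpa using this

/-- An invariant subspace is the sum of its intersections with the generalized eigenspaces. Here
these are whole eigenspaces when `v c < 1` and zero otherwise, and their dimensions are the
multiplicities of the roots. -/
lemma finrank_contracted_eq_card [IsAlgClosed L] [DecidableEq L]
    (A : Matrix (Fin n) (Fin n) ℤ) :
    Module.finrank L (contracted v A) =
      ((A.charpoly.map (Int.castRingHom L)).roots.filter fun c => v c < 1).card := by
  set φ := toFieldEnd L A with hφ
  have hh := charpoly_toFieldEnd (L := L) A
  set h := A.charpoly.map (Int.castRingHom L) with hhdef
  have hmonic : h.Monic := A.charpoly_monic.map _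
  let I := {c // c ∈ h.roots.toFinset.filter fun c => v c < 1}
  let E : I → Submodule L (Fin n → L) := fun c => φ.maxGenEigenspace c
  have hind : iSupIndep E :=
    φ.independent_maxGenEigenspace.comp Subtype.val_injective
  have hD : contracted v A = ⨆ c, E c := by
    apply le_antisymm
    · have hinv : ∀ x ∈ contracted v A, φ x ∈ contracted v A := fun x hx => by
        rw [hφ, Matrix.toLin'_apply]
        exact toField_mulVec_mem_contracted v hx
      have h1 := Submodule.eq_iSup_inf_genEigenspace ⊤ hinv
        (Module.End.iSup_maxGenEigenspace_eq_top φ)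
      rw [h1]
      refine iSup_le fun c => ?_
      by_cases hc : v c < 1
      · by_cases hr : h.IsRoot c
        · exact inf_le_right.trans (le_iSup E
            ⟨c, by simp [hc, hmonic.ne_zero, hr.eq_zero]⟩)
        · have h0 : Module.finrank L (φ.maxGenEigenspace c) = 0 := by
            rw [LinearMap.finrank_maxGenEigenspace_eq, hh]
            exact rootMultiplicity_eq_zero hr
          rw [Submodule.finrank_eq_zero] at h0
          have : contracted v A ⊓ φ.genEigenspace c ⊤ ≤ ⊥ := inf_le_right.trans h0.le
          exact this.trans bot_le
      · exact (contracted_inf_maxGenEigenspace v A hc).le.trans bot_le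
    · refine iSup_le fun c => maxGenEigenspace_le_contracted v A ?_
      exact (Finset.mem_filter.1 c.2).2
  have hsum : Module.finrank L (contracted v A) = ∑ c : I, Module.finrank L (E c) := by
    rw [hD, Submodule.iSup_eq_range_dfinsupp_lsum,
      LinearMap.finrank_range_of_inj hind.dfinsupp_lsum_injective]
    exact Module.finrank_directSum (R := L) fun c => E c
  rw [hsum, ← Multiset.toFinset_sum_count_eq, Multiset.toFinset_filter]
  rw [← Finset.sum_coe_sort _ fun c => Multiset.count c (h.roots.filter fun c => v c < 1)]
  refine Finset.sum_congr rfl fun c _ => ?_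
  rw [Multiset.count_filter_of_pos (p := fun c => v c < 1) (Finset.mem_filter.1 c.2).2, count_roots]
  exact (LinearMap.finrank_maxGenEigenspace_eq φ c).trans (congrArg (rootMultiplicity (c : L)) hh)

/-- The multiplicity of zero modulo `p` counts the roots in the maximal ideal. -/
lemma rootMultiplicity_zero_map_zmod [IsAlgClosed L] [DecidableEq L] {p : ℕ} (hp : p.Prime)
    (hvp : v (p : L) < 1) {f : ℤ[X]} (hf : f.Monic) :
    (f.map (Int.castRingHom (ZMod p))).rootMultiplicity 0 =
      ((f.map (Int.castRingHom L)).roots.filter fun c => v c < 1).card := by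
  have := Fact.mk hp
  let O := v.valuationSubring
  let k := IsLocalRing.ResidueField O
  have hres : ∀ x : O, IsLocalRing.residue O x = 0 ↔ v (x : L) < 1 := fun x => by
    rw [IsLocalRing.residue_eq_zero_iff, IsLocalRing.mem_maximalIdeal, mem_nonunits_iff]
    exact Valuation.Integer.not_isUnit_iff_valuation_lt_one (v := v) (x := x)
  have hchar : CharP k p := by
    refine (CharP.charP_iff_prime_eq_zero hp).2 ?_
    rw [← map_natCast (IsLocalRing.residue O), hres]
    simpa using hvp
  -- The roots of `f` are integral over `ℤ`, hence lie in the valuation ring, so the factorization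
  -- of `f` into linear factors can be reduced to the residue field.
  obtain ⟨s, hs⟩ : ∃ s : Multiset O, s.map Subtype.val = (f.map (Int.castRingHom L)).roots := by
    have hmem : ∀ x ∈ (f.map (Int.castRingHom L)).roots, x ∈ O := fun x hx =>
      valuation_le_one_of_isRoot v hf ((mem_roots (hf.map _).ne_zero).1 hx)
    refine ⟨(f.map (Int.castRingHom L)).roots.pmap Subtype.mk hmem, ?_⟩
    rw [Multiset.map_pmap]
    simp [Multiset.pmap_eq_map]
  have hO : f.map (Int.castRingHom O) = (s.map fun a => X - C a).prod := by
    apply Polynomial.map_injective O.subtype Subtype.val_injective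
    rw [Polynomial.map_map, Polynomial.map_multiset_prod, Multiset.map_map,
      RingHom.ext_int (O.subtype.comp (Int.castRingHom O)) (Int.castRingHom L),
      (IsAlgClosed.splits (f.map (Int.castRingHom L))).eq_prod_roots_of_monic (hf.map _),
      ← hs, Multiset.map_map]
    simp
  have hk : f.map (Int.castRingHom k) =
      ((s.map (IsLocalRing.residue O)).map fun a => X - C a).prod := by
    rw [RingHom.ext_int (Int.castRingHom k) ((IsLocalRing.residue O).comp (Int.castRingHom O)),
      ← Polynomial.map_map, hO, Polynomial.map_multiset_prod, Multiset.map_map, Multiset.map_map]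
    simp
  -- The residue field has characteristic `p` and contains `ZMod p`; multiplicities of roots do not
  -- change in a field extension.
  have h1 : (f.map (Int.castRingHom (ZMod p))).rootMultiplicity 0 =
      (f.map (Int.castRingHom k)).rootMultiplicity 0 := by
    have := eq_rootMultiplicity_map (p := f.map (Int.castRingHom (ZMod p)))
      (ZMod.castHom dvd_rfl k).injective 0
    rwa [map_zero, Polynomial.map_map,
      RingHom.ext_int ((ZMod.castHom dvd_rfl k).comp (Int.castRingHom (ZMod p)))
        (Int.castRingHom k)] at this
  classical
  rw [h1, ← count_roots, hk, roots_multiset_prod_X_sub_C, ← hs, Multiset.filter_map,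
    Multiset.card_map, Multiset.count_map]
  congr 1
  refine Multiset.filter_congr fun x _ => ?_
  rw [eq_comm, hres]
  rfl

lemma finrank_contracted [IsAlgClosed L] {p : ℕ} (hp : p.Prime) (hvp : v (p : L) < 1)
    (A : Matrix (Fin n) (Fin n) ℤ) : Module.finrank L (contracted v A) = t p A := by
  classical
  rw [finrank_contracted_eq_card, t, charpolyMod,
    rootMultiplicity_zero_map_zmod v hp hvp A.charpoly_monic]

end Contraction

/-! ### A valuation above `p` -/

instance : Algebra.IsAlgebraic ℚ QBar := AlgebraicClosure.isAlgebraic ℚ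

/-- There is a valuation of `Q̄` above `p`. -/
lemma exists_valuation_lt_one {p : ℕ} (hp : p.Prime) :
    ∃ v : Valuation QBar NNReal, v (p : QBar) < 1 := by
  have := Fact.mk hp
  -- The valuation is pulled back from an algebraic closure of the `p`-adic numbers.
  let f : QBar →ₐ[ℚ] PadicAlgCl p := IsAlgClosed.lift
  refine ⟨(Valued.v : Valuation (PadicAlgCl p) NNReal).comap f.toRingHom, ?_⟩
  rw [Valuation.comap_apply, map_natCast, PadicAlgCl.valuation_p, one_div]
  exact inv_lt_one_of_one_lt₀ (by exact_mod_cast hp.one_lt)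

/-! ### Galois descent and commutation -/

section Descent

variable {K L : Type*} [Field K] [Field L] [Algebra K L] {n : ℕ}

/-- A subspace is invariant under all matrices, with entries in a subfield, of a given set. -/
def IsInvariant (s : Set (Matrix (Fin n) (Fin n) K)) (U : Submodule L (Fin n → L)) : Prop :=
  ∀ M ∈ s, ∀ x ∈ U, Matrix.mulVec (M.map (algebraMap K L)) x ∈ U

lemma IsInvariant.inf {s : Set (Matrix (Fin n) (Fin n) K)} {U V : Submodule L (Fin n → L)}
    (hU : IsInvariant s U) (hV : IsInvariant s V) : IsInvariant s (U ⊓ V) :=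
  fun M hM x hx => ⟨hU M hM x hx.1, hV M hM x hx.2⟩

lemma IsInvariant.sup {s : Set (Matrix (Fin n) (Fin n) K)} {U V : Submodule L (Fin n → L)}
    (hU : IsInvariant s U) (hV : IsInvariant s V) : IsInvariant s (U ⊔ V) := by
  intro M hM x hx
  obtain ⟨y, hy, z, hz, rfl⟩ := Submodule.mem_sup.1 hx
  rw [Matrix.mulVec_add]
  exact Submodule.add_mem_sup (hU M hM y hy) (hV M hM z hz)

lemma isInvariant_sSup {s : Set (Matrix (Fin n) (Fin n) K)} {F : Set (Submodule L (Fin n → L))}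
    (hF : ∀ U ∈ F, IsInvariant s U) : IsInvariant s (sSup F) := by
  intro M hM x hx
  have : sSup F ≤ (sSup F).comap (Matrix.mulVecLin (M.map (algebraMap K L))) :=
    sSup_le fun U hU x hx => (le_sSup hU : U ≤ _) (hF U hU M hM x hx)
  exact this hx

/-- The Galois conjugate of a subspace. -/
def conjugate (σ : L ≃ₐ[K] L) (U : Submodule L (Fin n → L)) : Submodule L (Fin n → L) where
  carrier := {x | (fun i => σ.symm (x i)) ∈ U}
  zero_mem' := by
    simp only [Set.mem_ofPred_eq, Pi.zero_apply, map_zero]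
    exact U.zero_mem
  add_mem' {x y} hx hy := by
    simp only [Set.mem_ofPred_eq, Pi.add_apply, map_add]
    exact U.add_mem hx hy
  smul_mem' c x hx := by
    simp only [Set.mem_ofPred_eq, Pi.smul_apply, smul_eq_mul, map_mul]
    exact U.smul_mem (σ.symm c) hx

lemma mem_conjugate_iff (σ : L ≃ₐ[K] L) (U : Submodule L (Fin n → L)) (x : Fin n → L) :
    x ∈ conjugate σ U ↔ (fun i => σ.symm (x i)) ∈ U := Iff.rfl

lemma comp_mem_conjugate_iff (σ : L ≃ₐ[K] L) (U : Submodule L (Fin n → L)) (x : Fin n → L) :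
    (fun i => σ (x i)) ∈ conjugate σ U ↔ x ∈ U := by
  simp [mem_conjugate_iff]

/-- Applying `σ` to coordinates is only `σ`-semilinear, but a semilinear bijection still preserves
rank. -/
lemma finrank_conjugate (σ : L ≃ₐ[K] L) (U : Submodule L (Fin n → L)) :
    Module.finrank L (conjugate σ U) = Module.finrank L U := by
  let e : U ≃+ conjugate σ U :=
    { toFun := fun x => ⟨fun i => σ (x.1 i), (comp_mem_conjugate_iff σ U _).2 x.2⟩
      invFun := fun x => ⟨fun i => σ.symm (x.1 i), x.2⟩
      left_inv := fun x => by ext; simp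
      right_inv := fun x => by ext; simp
      map_add' := fun x y => by ext; simp }
  have := rank_eq_of_equiv_equiv (σ : L → L) e σ.bijective fun c x => by ext; simp [e]
  rw [Module.finrank, Module.finrank, this]

lemma IsInvariant.conjugate {s : Set (Matrix (Fin n) (Fin n) K)} {U : Submodule L (Fin n → L)}
    (hU : IsInvariant s U) (σ : L ≃ₐ[K] L) : IsInvariant s (conjugate σ U) := by
  intro M hM x hx
  rw [mem_conjugate_iff] at hx ⊢
  convert! hU M hM _ hx using 1
  ext i
  simp [Matrix.mulVec, dotProduct]

/-- A non-zero subspace stable under the Galois group contains a non-zero vector over the base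
field. -/
lemma exists_rational_mem [IsGalois K L] {X : Submodule L (Fin n → L)} (hX : X ≠ ⊥)
    (hσ : ∀ (σ : L ≃ₐ[K] L), ∀ x ∈ X, (fun i => σ (x i)) ∈ X) :
    ∃ w : Fin n → K, w ≠ 0 ∧ (fun i => algebraMap K L (w i)) ∈ X := by
  classical
  let supp : (Fin n → L) → Finset (Fin n) := fun x => Finset.univ.filter fun i => x i ≠ 0
  have hex : ∃ d, ∃ x ∈ X, x ≠ 0 ∧ (supp x).card = d := by
    obtain ⟨x, hx, h0⟩ := X.ne_bot_iff.1 hX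
    exact ⟨_, x, hx, h0, rfl⟩
  -- A non-zero vector of smallest support, scaled so that one coordinate is `1`, turns out to be
  -- fixed by the Galois group.
  obtain ⟨x, hx, h0, hd⟩ := Nat.find_spec hex
  have hmin : ∀ y ∈ X, (supp y).card < (supp x).card → y = 0 := fun y hy hlt => by
    by_contra hy0
    exact Nat.find_min hex (hd ▸ hlt) ⟨y, hy, hy0, rfl⟩
  obtain ⟨i₀, hi₀⟩ := Function.ne_iff.1 h0
  rw [Pi.zero_apply] at hi₀
  let y : Fin n → L := (x i₀)⁻¹ • x
  have hy : y ∈ X := X.smul_mem _ hx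
  have hyi : y i₀ = 1 := by simp [y, hi₀]
  have hysupp : supp y = supp x := by
    ext i
    simp [supp, y, hi₀]
  have hfix : ∀ (σ : L ≃ₐ[K] L) i, σ (y i) = y i := by
    intro σ i
    -- The difference `σ y - y` is supported in the support of `y` and vanishes at `i₀`, so
    -- minimality makes it zero.
    have hz := hmin ((fun i => σ (y i)) - y) (X.sub_mem (hσ σ y hy) hy) (by
      rw [← hysupp]
      refine Finset.card_lt_card ⟨fun j hj => ?_, fun hsub => ?_⟩
      · simp only [supp, Finset.mem_filter, Finset.mem_univ, true_and, Pi.sub_apply] at hj ⊢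
        contrapose! hj
        simp [hj]
      · have := hsub (show i₀ ∈ supp y by simp [supp, hyi])
        simp [supp, hyi] at this)
    simpa [sub_eq_zero] using congrFun hz i
  choose w hw using fun i => (InfiniteGalois.mem_range_algebraMap_iff_fixed (k := K) (y i)).2
    fun σ => hfix σ i
  refine ⟨w, fun hw0 => ?_, ?_⟩
  · have := hw i₀
    rw [hw0, hyi] at this
    simp at this
  · simpa only [hw] using hy

/-- The dimensions of all invariant subspaces are multiples of the least positive one, if the
subspaces of least dimension span. -/
lemma dvd_finrank_of_isInvariant {s : Set (Matrix (Fin n) (Fin n) K)} {d : ℕ}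
    (hmin : ∀ U : Submodule L (Fin n → L), IsInvariant s U → U ≠ ⊥ → d ≤ Module.finrank L U)
    (hspan : sSup {U : Submodule L (Fin n → L) | IsInvariant s U ∧ Module.finrank L U = d} = ⊤)
    {D : Submodule L (Fin n → L)} (hD : IsInvariant s D) : d ∣ n - Module.finrank L D := by
  induction hr : n - Module.finrank L D using Nat.strong_induction_on generalizing D with
  | _ r ih =>
  by_cases htop : D = ⊤
  · rw [← hr, htop, finrank_top, Module.finrank_fin_fun]
    simp
  obtain ⟨U, ⟨hU, hUd⟩, hUD⟩ : ∃ U ∈ {U : Submodule L (Fin n → L) | IsInvariant s U ∧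
      Module.finrank L U = d}, ¬ U ≤ D := by
    by_contra! h
    exact htop (top_le_iff.1 (hspan ▸ sSup_le h))
  have hlt : D < ⊤ := lt_top_iff_ne_top.2 htop
  -- A non-zero intersection would be invariant of dimension at least `d = dim U`, hence equal to
  -- `U`. So adding `U` raises the dimension of `D` by exactly `d`, and induction on the codimension
  -- applies.
  have hinf : D ⊓ U = ⊥ := by
    by_contra hne
    have h1 := hmin _ (hD.inf hU) hne
    have h2 : D ⊓ U = U := Submodule.eq_of_le_of_finrank_le inf_le_right (hUd ▸ h1)
    exact hUD (inf_eq_right.1 h2)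
  have hdim := Submodule.finrank_sup_add_finrank_inf_eq D U
  rw [hinf, finrank_bot, add_zero, hUd] at hdim
  have hle := Submodule.finrank_le (D ⊔ U)
  rw [Module.finrank_fin_fun] at hle
  have hd : 0 < d := by
    rw [← hUd, Module.finrank_pos_iff]
    exact Submodule.nontrivial_iff_ne_bot.2 fun h => hUD (h ▸ bot_le)
  have := ih (n - Module.finrank L ↥(D ⊔ U)) (by omega) (hD.sup hU) rfl
  obtain ⟨c, hc⟩ := this
  exact ⟨c + 1, by rw [mul_add, mul_one, ← hc]; omega⟩

/-- If a set of matrices over `K` has no common invariant subspace, but over a Galois extension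
there is one of dimension prime to `n`, then the matrices commute. -/
theorem commute_of_coprime_finrank [IsGalois K L] (hn : 0 < n) {s : Set (Matrix (Fin n) (Fin n) K)}
    (hirr : ∀ V : Submodule K (Fin n → K), (∀ M ∈ s, ∀ x ∈ V, Matrix.mulVec M x ∈ V) →
      V = ⊥ ∨ V = ⊤)
    {D : Submodule L (Fin n → L)} (hD : IsInvariant s D)
    (hcop : Nat.gcd n (Module.finrank L D) = 1) {M N : Matrix (Fin n) (Fin n) K} (hM : M ∈ s)
    (hN : N ∈ s) : M * N = N * M := by
  classical
  have hex : ∃ d, ∃ U : Submodule L (Fin n → L), IsInvariant s U ∧ U ≠ ⊥ ∧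
      Module.finrank L U = d := by
    have : Nonempty (Fin n) := ⟨⟨0, hn⟩⟩
    exact ⟨_, ⊤, fun _ _ _ _ => Submodule.mem_top, top_ne_bot, rfl⟩
  obtain ⟨U₀, hU₀, hU₀b, hU₀d⟩ := Nat.find_spec hex
  set d := Nat.find hex with hd
  have hmin : ∀ U : Submodule L (Fin n → L), IsInvariant s U → U ≠ ⊥ →
      d ≤ Module.finrank L U := fun U hU hUb => Nat.find_min' hex ⟨U, hU, hUb, rfl⟩
  set F := {U : Submodule L (Fin n → L) | IsInvariant s U ∧ Module.finrank L U = d} with hF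
  have hinv : IsInvariant s (sSup F) := isInvariant_sSup fun U hU => hU.1
  -- The sum of the minimal subspaces is Galois-stable, so it contains a non-zero vector over `K`.
  -- Its `K`-points form an invariant subspace, which is then all of `Kⁿ`.
  have hspan : sSup F = ⊤ := by
    have hne : sSup F ≠ ⊥ := fun h =>
      hU₀b (le_bot_iff.1 (h ▸ le_sSup (show U₀ ∈ F from ⟨hU₀, hU₀d⟩)))
    have hσ : ∀ (σ : L ≃ₐ[K] L), ∀ x ∈ sSup F, (fun i => σ (x i)) ∈ sSup F := by
      intro σ x hx
      have : sSup F ≤ conjugate σ.symm (sSup F) := by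
        refine sSup_le fun U hU y hy => ?_
        have hmem : conjugate σ U ∈ F := ⟨hU.1.conjugate σ, by rw [finrank_conjugate, hU.2]⟩
        exact (le_sSup hmem : conjugate σ U ≤ _) ((comp_mem_conjugate_iff σ U y).2 hy)
      exact this hx
    obtain ⟨w, hw0, hw⟩ := exists_rational_mem hne hσ
    let V : Submodule K (Fin n → K) :=
      ((sSup F).restrictScalars K).comap (LinearMap.compLeft (Algebra.linearMap K L) (Fin n))
    have hVmem : ∀ x, x ∈ V ↔ (fun i => algebraMap K L (x i)) ∈ sSup F := fun x => Iff.rfl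
    have hV : ∀ M ∈ s, ∀ x ∈ V, Matrix.mulVec M x ∈ V := by
      intro M hM x hx
      rw [hVmem] at hx ⊢
      convert! hinv M hM _ hx using 1
      ext i
      simp [Matrix.mulVec, dotProduct]
    rcases hirr V hV with h | h
    · exact absurd ((Submodule.mem_bot K).1 (h ▸ (hVmem w).2 hw)) hw0
    · rw [eq_top_iff, ← (Pi.basisFun L (Fin n)).span_eq, Submodule.span_le]
      rintro _ ⟨i, rfl⟩
      have : Pi.single i 1 ∈ V := h ▸ Submodule.mem_top
      rw [hVmem] at this
      convert! this using 1
      ext j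
      simp [Pi.single_apply, apply_ite]
  -- The zero subspace has codimension `n`.
  have hdn : d ∣ n := by
    simpa using dvd_finrank_of_isInvariant hmin hspan
      (show IsInvariant s (⊥ : Submodule L (Fin n → L)) from fun M _ x hx => by
        rw [Submodule.mem_bot] at hx ⊢
        simp [hx])
  have hdD : d ∣ Module.finrank L D := by
    have hle := Submodule.finrank_le D
    rw [Module.finrank_fin_fun] at hle
    exact (Nat.dvd_sub_iff_right hle hdn).1 (dvd_finrank_of_isInvariant hmin hspan hD)
  have hd1 : d = 1 := Nat.dvd_one.1 (hcop ▸ Nat.dvd_gcd hdn hdD)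
  let m : Matrix (Fin n) (Fin n) K →+* Matrix (Fin n) (Fin n) L := (algebraMap K L).mapMatrix
  -- As `d = 1`, the members of `F` are lines spanned by common eigenvectors, and the commutator
  -- kills each of them.
  have hcomm : sSup F ≤ LinearMap.ker (Matrix.mulVecLin (m M * m N - m N * m M)) := by
    refine sSup_le fun U hU x hx => ?_
    by_cases hx0 : x = 0
    · rw [hx0]
      exact zero_mem _
    have hline := fun y (hy : y ∈ U) => (finrank_eq_one_iff_of_nonzero' (⟨x, hx⟩ : U)
      (by simpa using hx0)).1 (hU.2.trans hd1) ⟨y, hy⟩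
    obtain ⟨a, ha⟩ := hline _ (hU.1 M hM x hx)
    obtain ⟨b, hb⟩ := hline _ (hU.1 N hN x hx)
    have ha' : Matrix.mulVec (m M) x = a • x := (congrArg Subtype.val ha).symm
    have hb' : Matrix.mulVec (m N) x = b • x := (congrArg Subtype.val hb).symm
    rw [LinearMap.mem_ker, Matrix.mulVecLin_apply, Matrix.sub_mulVec, ← Matrix.mulVec_mulVec,
      ← Matrix.mulVec_mulVec, ha', hb', Matrix.mulVec_smul, Matrix.mulVec_smul, ha', hb',
      smul_comm, sub_self]
  rw [hspan, top_le_iff, LinearMap.ker_eq_top] at hcomm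
  have hzero : m M * m N - m N * m M = 0 := by
    apply Matrix.mulVec_injective
    ext x
    rw [← Matrix.mulVecLin_apply, hcomm]
    simp
  rw [sub_eq_zero, ← map_mul, ← map_mul] at hzero
  exact Matrix.map_injective (algebraMap K L).injective hzero

end Descent

/-! ### Irreducible factors and eigenvectors -/

lemma exists_monic_irreducible_dvd {h : ℤ[X]} (hm : h.Monic) (h1 : h ≠ 1) :
    ∃ q, Irreducible q ∧ q.Monic ∧ q ∣ h := by
  obtain ⟨q, hq, g, hg⟩ := WfDvdMonoid.exists_irreducible_factor
    (fun hu => h1 (hm.eq_one_of_isUnit hu)) hm.ne_zero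
  have hlc : IsUnit q.leadingCoeff := by
    refine IsUnit.of_mul_eq_one g.leadingCoeff ?_
    rw [← leadingCoeff_mul, ← hg, hm.leadingCoeff]
  rcases Int.isUnit_iff.1 hlc with h | h
  · exact ⟨q, hq, h, g, hg⟩
  · refine ⟨-q, (Associated.neg_left_iff.2 (Associated.refl q)).symm.irreducible hq, ?_,
      neg_dvd.2 ⟨g, hg⟩⟩
    rw [Monic, leadingCoeff_neg, h, neg_neg]

lemma eq_pow_of_unique_irreducible_factor {q : ℤ[X]} {h : ℤ[X]} (hm : h.Monic)
    (hq : ∀ q', Irreducible q' → q'.Monic → q' ∣ h → q' = q) : ∃ r, h = q ^ r := by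
  induction hd : h.natDegree using Nat.strong_induction_on generalizing h with
  | _ d ih =>
  by_cases h1 : h = 1
  · exact ⟨0, by simp [h1]⟩
  obtain ⟨q', hq', hm', g, rfl⟩ := exists_monic_irreducible_dvd hm h1
  obtain rfl := hq q' hq' hm' (dvd_mul_right _ _)
  have hg : g.Monic := hm'.of_mul_monic_left hm
  have hpos : 0 < q'.natDegree :=
    Nat.pos_of_ne_zero fun h0 => hq'.not_isUnit (by
       rw [(Monic.natDegree_eq_zero hm').1 h0]; simp)
  obtain ⟨r, hr⟩ := ih g.natDegree (by rw [← hd, hm'.natDegree_mul hg]; omega) hg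
    (fun q'' h1 h2 h3 => hq q'' h1 h2 (h3.mul_left _)) rfl
  exact ⟨r + 1, by rw [pow_succ', ← hr]⟩

section Eigen

variable {F : Type*} [Field F] {n : ℕ}

lemma exists_mulVec_eq_smul_of_isRoot {M : Matrix (Fin n) (Fin n) F} {a : F}
    (ha : M.charpoly.IsRoot a) : ∃ u, u ≠ 0 ∧ Matrix.mulVec M u = a • u := by
  rw [← Matrix.charpoly_toLin', ← Module.End.hasEigenvalue_iff_isRoot_charpoly] at ha
  obtain ⟨u, hu⟩ := ha.exists_hasEigenvector
  exact ⟨u, hu.2, by simpa using hu.apply_eq_smul⟩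

/-- The endomorphism given by a square matrix. -/
noncomputable abbrev matrixEnd (M : Matrix (Fin n) (Fin n) F) : Module.End F (Fin n → F) :=
  Matrix.toLin' M

lemma hasEigenvector_matrixEnd {M : Matrix (Fin n) (Fin n) F} {a : F} {u : Fin n → F} (hu : u ≠ 0)
    (h : Matrix.mulVec M u = a • u) : (matrixEnd M).HasEigenvector a u :=
  ⟨Module.End.mem_eigenspace_iff.2 (by simpa using h), hu⟩

lemma isRoot_charpoly_of_mulVec_eq_smul {M : Matrix (Fin n) (Fin n) F} {a : F} {u : Fin n → F}
    (hu : u ≠ 0) (h : Matrix.mulVec M u = a • u) : M.charpoly.IsRoot a := by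
  rw [← Matrix.charpoly_toLin', ← Module.End.hasEigenvalue_iff_isRoot_charpoly]
  exact Module.End.hasEigenvalue_of_hasEigenvector (hasEigenvector_matrixEnd hu h)

/-- An eigenvector of a matrix with separable characteristic polynomial is an eigenvector of every
commuting matrix. -/
lemma exists_mulVec_eq_smul_of_commute {M N : Matrix (Fin n) (Fin n) F}
    (hsep : M.charpoly.Separable) (hMN : M * N = N * M) {a : F} {u : Fin n → F} (hu : u ≠ 0)
    (h : Matrix.mulVec M u = a • u) : ∃ b : F, Matrix.mulVec N u = b • u := by
  have hmem : ∀ y, y ∈ (matrixEnd M).eigenspace a ↔ Matrix.mulVec M y = a • y := fun y => by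
    rw [Module.End.mem_eigenspace_iff, Matrix.toLin'_apply]
  have hle := (LinearMap.finrank_eigenspace_le (Matrix.toLin' M) a).trans
    (rootMultiplicity_le_one_of_separable (by rwa [Matrix.charpoly_toLin']) a)
  have hN : Matrix.mulVec N u ∈ (matrixEnd M).eigenspace a := by
    rw [hmem, Matrix.mulVec_mulVec, hMN, ← Matrix.mulVec_mulVec, h, Matrix.mulVec_smul]
  have hu' : (⟨u, (hmem u).2 h⟩ : (matrixEnd M).eigenspace a) ≠ 0 := by simpa using hu
  have hone : Module.finrank F ((matrixEnd M).eigenspace a) = 1 := by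
    refine le_antisymm hle (Module.finrank_pos_iff.2 ⟨_, 0, hu'⟩)
  obtain ⟨b, hb⟩ := (finrank_eq_one_iff_of_nonzero' _ hu').1 hone ⟨_, hN⟩
  exact ⟨b, (congrArg Subtype.val hb).symm⟩

end Eigen

/-- If polynomials in a rational matrix are zero or invertible and the multiplicity of zero of its
characteristic polynomial modulo `p` is prime to the size, that polynomial is irreducible. -/
lemma irreducible_of_aeval_eq_zero_or_isUnit {n : ℕ} (hn : 0 < n) {h : ℤ[X]} (hm : h.Monic)
    {M : Matrix (Fin n) (Fin n) ℚ} (hM : M.charpoly = h.map (Int.castRingHom ℚ))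
    (hpoly : ∀ f : ℚ[X], aeval M f = 0 ∨ IsUnit (aeval M f)) {p : ℕ} (hp : p.Prime)
    (hcop : Nat.gcd n ((h.map (Int.castRingHom (ZMod p))).rootMultiplicity 0) = 1) :
    Irreducible h := by
  have := Fact.mk hp
  have : Nonempty (Fin n) := ⟨⟨0, hn⟩⟩
  have hdeg : h.natDegree = n := by
    rw [← hm.natDegree_map (Int.castRingHom ℚ), ← hM, Matrix.charpoly_natDegree_eq_dim,
      Fintype.card_fin]
  have hzero : ∀ q : ℤ[X], Irreducible q → q.Monic → q ∣ h →
      aeval M (q.map (Int.castRingHom ℚ)) = 0 := by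
    intro q hq hqm hqh
    -- A root of `q` is an eigenvalue of `M` over `Q̄`, and `q(M)` kills the corresponding
    -- eigenvector, so it is not invertible.
    refine (hpoly _).resolve_right fun hunit => ?_
    have hqd : (q.map (algebraMap ℤ QBar)).degree ≠ 0 := by
      rw [hqm.degree_map]
      intro h0
      rw [(Monic.natDegree_eq_zero hqm).1 (natDegree_eq_of_degree_eq_some h0)] at hq
      exact hq.not_isUnit isUnit_one
    obtain ⟨c, hc⟩ := IsAlgClosed.exists_root _ hqd
    let m : Matrix (Fin n) (Fin n) ℚ →+* Matrix (Fin n) (Fin n) QBar :=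
      (algebraMap ℚ QBar).mapMatrix
    have hroot : (m M).charpoly.IsRoot c := by
      have : (m M).charpoly = h.map (algebraMap ℤ QBar) := by
        change (M.map (algebraMap ℚ QBar)).charpoly = _
        rw [Matrix.charpoly_map, hM, Polynomial.map_map]
        congr 1
      rw [this]
      exact hc.dvd (Polynomial.map_dvd _ hqh)
    obtain ⟨u, hu, hMu⟩ := exists_mulVec_eq_smul_of_isRoot hroot
    have heig := Module.End.aeval_apply_of_hasEigenvector (p := q.map (algebraMap ℤ QBar))
      (hasEigenvector_matrixEnd hu hMu)
    rw [hc.eq_zero, zero_smul] at heig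
    have hmap : m (aeval M (q.map (Int.castRingHom ℚ))) =
        aeval (m M) (q.map (algebraMap ℤ QBar)) := by
      rw [show Int.castRingHom ℚ = algebraMap ℤ ℚ from rfl, aeval_map_algebraMap,
        aeval_map_algebraMap]
      exact (aeval_algHom_apply m.toIntAlgHom M q).symm
    have hunit' : IsUnit (aeval (m M) (q.map (algebraMap ℤ QBar))) := hmap ▸ hunit.map m
    have h0 : Matrix.mulVec (aeval (m M) (q.map (algebraMap ℤ QBar))) u = 0 := by
      rw [← heig, ← Matrix.toLinAlgEquiv'_apply, ← AlgEquiv.coe_toAlgHom, ← aeval_algHom_apply]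
      rfl
    obtain ⟨N, hN⟩ := hunit'.exists_left_inv
    apply hu
    rw [← Matrix.one_mulVec u, ← hN, ← Matrix.mulVec_mulVec, h0, Matrix.mulVec_zero]
  have huniq : ∀ q q' : ℤ[X], Irreducible q → q.Monic → q ∣ h → Irreducible q' → q'.Monic →
      q' ∣ h → q = q' := by
    intro q q' hq hqm hqh hq' hqm' hqh'
    have hirr := (hqm.irreducible_iff_irreducible_map_fraction_map (K := ℚ)).1 hq
    have hirr' := (hqm'.irreducible_iff_irreducible_map_fraction_map (K := ℚ)).1 hq'
    apply Polynomial.map_injective (algebraMap ℤ ℚ) (algebraMap ℤ ℚ).injective_int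
    by_contra hne
    -- Two distinct monic irreducible factors would be coprime over `ℚ`; both annihilate `M`, and
    -- Bézout would give `0 = 1`.
    have hco : IsCoprime (q.map (algebraMap ℤ ℚ)) (q'.map (algebraMap ℤ ℚ)) := by
      refine (hirr.coprime_iff_not_dvd).2 fun hdvd => hne ?_
      exact eq_of_monic_of_associated (hqm.map _) (hqm'.map _)
        (hirr.associated_of_dvd hirr' hdvd)
    obtain ⟨a, b, hab⟩ := hco
    have := congrArg (aeval M) hab
    rw [map_add, map_mul, map_mul, map_one, show algebraMap ℤ ℚ = Int.castRingHom ℚ from rfl,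
      hzero q hq hqm hqh, hzero q' hq' hqm' hqh', mul_zero, mul_zero, add_zero] at this
    exact zero_ne_one this
  obtain ⟨q, hq, hqm, hqh⟩ := exists_monic_irreducible_dvd hm (fun h1 => by
    rw [h1, natDegree_one] at hdeg
    omega)
  obtain ⟨r, hr⟩ := eq_pow_of_unique_irreducible_factor hm
    (fun q' h1 h2 h3 => huniq q' q h1 h2 h3 hq hqm hqh)
  have hr1 : r ∣ 1 := by
    -- For `h = q ^ r`, both the degree `n` and the multiplicity of zero modulo `p` are multiples of
    -- `r`.
    rw [← hcop]
    refine Nat.dvd_gcd ⟨q.natDegree, ?_⟩ ⟨(q.map (Int.castRingHom (ZMod p))).roots.count 0, ?_⟩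
    · rw [← hdeg, hr, hqm.natDegree_pow]
    · rw [hr, Polynomial.map_pow, ← count_roots, roots_pow, Multiset.count_nsmul]
  rw [hr, Nat.dvd_one.1 hr1, pow_one]
  exact hq

/-! ### Integrality of isomorphisms and invariance of `t_p` -/

section Intertwining

variable {n : ℕ} {A B : Matrix (Fin n) (Fin n) ℤ} {T : Matrix.GeneralLinearGroup (Fin n) ℚ}

lemma isIso_symm (hT : IsIso A B T) : IsIso B A T⁻¹ := by
  rw [IsIso, ← hT, Set.image_image]
  simp only [Matrix.mulVec_mulVec, GL_val_inv_mul, Matrix.one_mulVec, Set.image_id']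

/-- An isomorphism of groups `G_A → G_B` is integral up to powers of `A` and `B`. -/
lemma exists_pow_mul_eq (hA : A.det ≠ 0) (hB : B.det ≠ 0) (hT : IsIso A B T) (k : ℕ) :
    ∃ (j : ℕ) (N : Matrix (Fin n) (Fin n) ℤ),
      toRat B ^ j * (T : Matrix (Fin n) (Fin n) ℚ) = toRat N * toRat A ^ k := by
  have hu : IsUnit (toRat A ^ k).det := by
    rw [Matrix.det_pow]
    exact (isUnit_det_toRat hA).pow k
  set R := (toRat A ^ k)⁻¹ with hR
  have hcol : ∀ i, ∃ (j : ℕ) (x : Fin n → ℤ),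
      Matrix.mulVec (toRat B ^ j) (Matrix.mulVec (T : Matrix (Fin n) (Fin n) ℚ)
        (Matrix.mulVec R (Pi.single i 1))) = ratVec x := by
    intro i
    rw [← mem_G_iff hB, ← hT]
    refine ⟨_, (mem_G_iff hA _).2 ⟨k, Pi.single i 1, ?_⟩, rfl⟩
    rw [Matrix.mulVec_mulVec, hR, Matrix.mul_nonsing_inv _ hu, Matrix.one_mulVec]
    ext l
    simp [Pi.single_apply]
  choose j x hx using hcol
  -- Each column of `T A⁻ᵏ` lies in `G_B` and needs its own power of `B` to become integral; the
  -- largest exponent serves for all columns.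
  let J := Finset.univ.sup j
  refine ⟨J, Matrix.of fun l i => Matrix.mulVec (B ^ (J - j i)) (x i) l, ?_⟩
  have key : toRat B ^ J * (T : Matrix (Fin n) (Fin n) ℚ) * R =
      toRat (Matrix.of fun l i => Matrix.mulVec (B ^ (J - j i)) (x i) l) := by
    refine Matrix.ext_of_mulVec_single fun i => ?_
    have hJ : J = (J - j i) + j i := (Nat.sub_add_cancel (Finset.le_sup (Finset.mem_univ i))).symm
    rw [← Matrix.mulVec_mulVec, ← Matrix.mulVec_mulVec]
    conv_lhs => rw [hJ]
    rw [pow_add, ← Matrix.mulVec_mulVec, hx, ← toRat_pow, toRat_mulVec, Matrix.mulVec_single_one]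
    rfl
  rw [← key, Matrix.mul_assoc, hR, Matrix.nonsing_inv_mul _ hu, Matrix.mul_one]

lemma mulVec_iso_mem_contracted {L : Type*} [Field L] [Algebra ℚ L] (v : Valuation L NNReal)
    (hA : A.det ≠ 0) (hB : B.det ≠ 0) (hT : IsIso A B T) {x : Fin n → L}
    (hx : x ∈ contracted v A) :
    Matrix.mulVec ((T : Matrix (Fin n) (Fin n) ℚ).map (algebraMap ℚ L)) x ∈ contracted v B := by
  refine mulVec_mem_contracted v (fun k => ?_) hx
  obtain ⟨j, N, h⟩ := exists_pow_mul_eq hA hB hT k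
  refine ⟨j, N, ?_⟩
  have hmap : ∀ M : Matrix (Fin n) (Fin n) ℤ,
      toField L M = (algebraMap ℚ L).mapMatrix (toRat M) := fun M => by
    ext
    simp
  rw [hmap, hmap, hmap, ← map_pow, ← map_pow, ← map_mul, ← h, map_mul]
  rfl

lemma map_GL_inv_mul {L : Type*} [Field L] [Algebra ℚ L] (T : Matrix.GeneralLinearGroup (Fin n) ℚ) :
    ((T⁻¹ : Matrix.GeneralLinearGroup (Fin n) ℚ) : Matrix (Fin n) (Fin n) ℚ).map (algebraMap ℚ L) *
      (T : Matrix (Fin n) (Fin n) ℚ).map (algebraMap ℚ L) = 1 := by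
  rw [← Matrix.map_mul, GL_val_inv_mul, Matrix.map_one _ (map_zero _) (map_one _)]

lemma finrank_contracted_le {L : Type*} [Field L] [Algebra ℚ L] (v : Valuation L NNReal)
    (hA : A.det ≠ 0) (hB : B.det ≠ 0) (hT : IsIso A B T) :
    Module.finrank L (contracted v A) ≤ Module.finrank L (contracted v B) := by
  let f : contracted v A →ₗ[L] contracted v B :=
    (Matrix.mulVecLin ((T : Matrix (Fin n) (Fin n) ℚ).map (algebraMap ℚ L))).restrict
      fun x hx => mulVec_iso_mem_contracted v hA hB hT hx
  refine LinearMap.finrank_le_finrank_of_injective (f := f) fun x y hxy => ?_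
  have h := congrArg (Matrix.mulVec (((T⁻¹ : Matrix.GeneralLinearGroup (Fin n) ℚ) :
    Matrix (Fin n) (Fin n) ℚ).map (algebraMap ℚ L))) (congrArg Subtype.val hxy)
  change Matrix.mulVec _ (Matrix.mulVec _ x.1) = Matrix.mulVec _ (Matrix.mulVec _ y.1) at h
  rw [Matrix.mulVec_mulVec, Matrix.mulVec_mulVec, map_GL_inv_mul, Matrix.one_mulVec,
    Matrix.one_mulVec] at h
  exact Subtype.ext h

/-- `t_p` is an isomorphism invariant. -/
lemma t_eq_of_isIso (hA : A.det ≠ 0) (hB : B.det ≠ 0) (hT : IsIso A B T) {p : ℕ}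
    (hp : p.Prime) : t p A = t p B := by
  obtain ⟨v, hv⟩ := exists_valuation_lt_one hp
  rw [← finrank_contracted v hp hv, ← finrank_contracted v hp hv]
  exact le_antisymm (finrank_contracted_le v hA hB hT)
    (finrank_contracted_le v hB hA (isIso_symm hT))

end Intertwining

/-! ### Prime divisors of matched eigenvalues -/

section Primes

variable {n : ℕ} {A B : Matrix (Fin n) (Fin n) ℤ} {T : Matrix.GeneralLinearGroup (Fin n) ℚ}

lemma vecMul_pow {K : Type*} [Field K] {M : Matrix (Fin n) (Fin n) K} {w : Fin n → K} {a : K}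
    (h : Matrix.vecMul w M = a • w) (k : ℕ) : Matrix.vecMul w (M ^ k) = a ^ k • w := by
  induction k with
  | zero => simp
  | succ k ih =>
    rw [pow_succ, ← Matrix.vecMul_vecMul, ih, Matrix.smul_vecMul, h, smul_smul, pow_succ]

/-- Comparison of divisibility by the eigenvalues for matched left eigenvectors. -/
lemma exists_pow_mul_eq_pow_mul {K : Type*} [Field K] [CharZero K] (hA : A.det ≠ 0)
    (hB : B.det ≠ 0) (hT : IsIso A B T) {w w' : Fin n → K}
    (hw : w = Matrix.vecMul w' ((T : Matrix (Fin n) (Fin n) ℚ).map (Rat.castHom K))) {a b : K}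
    (ha : Matrix.vecMul w (toField K A) = a • w) (hb : Matrix.vecMul w' (toField K B) = b • w')
    (i : Fin n) (k : ℕ) :
    ∃ (j : ℕ) (z : Fin n → ℤ), a ^ j * w' i = b ^ k * ∑ l, w l * z l := by
  have hmap : ∀ (M : Matrix (Fin n) (Fin n) ℤ) (l : ℕ),
      (toRat M ^ l).map (Rat.castHom K) = toField K M ^ l := fun M l => by
    rw [Matrix.map_pow]
    congr 1
    ext
    simp
  have hu : IsUnit (toRat B ^ k).det := by
    rw [Matrix.det_pow]
    exact (isUnit_det_toRat hB).pow k
  -- The vector `B⁻ᵏ eᵢ` of `G_B` equals `T x` with `x ∈ G_A` and `Aʲ x = z` integral. Pairing with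
  -- the left eigenvectors gives `w' i = b ^ k (w · x)` and `a ^ j (w · x) = w · z`.
  have hy : Matrix.mulVec (toRat B ^ k)⁻¹ (Pi.single i 1) ∈ G B := by
    refine (mem_G_iff hB _).2 ⟨k, Pi.single i 1, ?_⟩
    rw [Matrix.mulVec_mulVec, Matrix.mul_nonsing_inv _ hu, Matrix.one_mulVec]
    ext l
    simp [Pi.single_apply]
  rw [← hT] at hy
  obtain ⟨x, hx, hxy⟩ := hy
  obtain ⟨j, z, hz⟩ := (mem_G_iff hA x).1 hx
  refine ⟨j, z, ?_⟩
  let c : (Fin n → ℚ) → (Fin n → K) := fun y i => (y i : K)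
  have hc : ∀ (M : Matrix (Fin n) (Fin n) ℚ) y,
      c (Matrix.mulVec M y) = Matrix.mulVec (M.map (Rat.castHom K)) (c y) := fun M y =>
    funext fun i => RingHom.map_mulVec (Rat.castHom K) M y i
  have h1 : b ^ k * dotProduct w (c x) = w' i := by
    have h : dotProduct w' (c (Matrix.mulVec (toRat B ^ k)
          (Matrix.mulVec (T : Matrix (Fin n) (Fin n) ℚ) x))) =
        dotProduct w' (c (Matrix.mulVec (toRat B ^ k)
          (Matrix.mulVec (toRat B ^ k)⁻¹ (Pi.single i 1)))) :=
      congrArg (fun y => dotProduct w' (c (Matrix.mulVec (toRat B ^ k) y))) hxy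
    rw [Matrix.mulVec_mulVec _ _ (toRat B ^ k)⁻¹, Matrix.mul_nonsing_inv _ hu, Matrix.one_mulVec, hc,
      hc, hmap, Matrix.dotProduct_mulVec, vecMul_pow hb, smul_dotProduct,
      Matrix.dotProduct_mulVec, ← hw, smul_eq_mul] at h
    rw [h, show c (Pi.single i 1) = Pi.single i 1 by ext l; simp [c, Pi.single_apply, apply_ite],
      dotProduct_single_one]
  have h2 : a ^ j * dotProduct w (c x) = ∑ l, w l * z l := by
    have h := congrArg (fun y => dotProduct w (c y)) hz
    rw [hc, hmap, Matrix.dotProduct_mulVec, vecMul_pow ha, smul_dotProduct, smul_eq_mul] at h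
    rw [h, dotProduct]
    simp [c]
  rw [← h1, ← h2]
  ring

/-- If `a ∉ I`, the relation `a ^ j * w' i = b ^ k * (w · z)`, cleared of denominators, puts a
non-zero multiple of `w' i` in `I ^ k` for every `k`. Krull's intersection theorem then forces `w' i
= 0`, contrary to the choice of `i`. -/
lemma mem_prime_of_mem_prime {K : Type*} [Field K] [NumberField K] (hA : A.det ≠ 0)
    (hB : B.det ≠ 0) (hT : IsIso A B T) {w w' : Fin n → K} (hw0 : w' ≠ 0)
    (hw : w = Matrix.vecMul w' ((T : Matrix (Fin n) (Fin n) ℚ).map (Rat.castHom K)))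
    {a b : NumberField.RingOfIntegers K}
    (ha : Matrix.vecMul w (toField K A) = (a : K) • w)
    (hb : Matrix.vecMul w' (toField K B) = (b : K) • w')
    {I : Ideal (NumberField.RingOfIntegers K)} (hI : I.IsPrime) (hbI : b ∈ I) : a ∈ I := by
  classical
  by_contra haI
  obtain ⟨d, hd, hint⟩ := exists_integral_multiples ℤ ℚ
    (Finset.univ.image w ∪ Finset.univ.image w')
  have hW : ∀ l, ∃ y : NumberField.RingOfIntegers K, (y : K) = d • w l := fun l =>
    ⟨⟨d • w l, hint _ (by simp)⟩, rfl⟩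
  have hW' : ∀ l, ∃ y : NumberField.RingOfIntegers K, (y : K) = d • w' l := fun l =>
    ⟨⟨d • w' l, hint _ (by simp)⟩, rfl⟩
  choose W hW using hW
  choose W' hW' using hW'
  obtain ⟨i, hi⟩ := Function.ne_iff.1 hw0
  have hmem : ∀ k, W' i ∈ I ^ k := by
    intro k
    obtain ⟨j, z, h⟩ := exists_pow_mul_eq_pow_mul hA hB hT hw ha hb i k
    have h' : a ^ j * W' i = b ^ k * ∑ l, W l * z l := by
      apply NumberField.RingOfIntegers.ext
      have := congrArg (d • ·) h
      simp only [zsmul_eq_mul] at this hW hW'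
      push_cast
      simp only [map_intCast, hW, hW', mul_assoc, ← Finset.mul_sum]
      linear_combination this
    have hp : a ^ j * W' i ∈ I ^ k := by
      rw [h']
      exact Ideal.mul_mem_right _ _ (Ideal.pow_mem_pow hbI k)
    -- In a Dedekind domain, a product in `I ^ k` with `I` prime has its first factor in `I` or its
    -- second in `I ^ k`.
    exact (Ideal.IsPrime.mul_mem_pow I hp).resolve_left fun h => haI (hI.mem_of_pow_mem j h)
  have hbot := Ideal.iInf_pow_eq_bot_of_isDomain I hI.ne_top
  have : W' i ∈ (⊥ : Ideal (NumberField.RingOfIntegers K)) := by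
    rw [← hbot]
    exact Ideal.mem_iInf.2 hmem
  rw [Ideal.mem_bot] at this
  have h0 := hW' i
  rw [this] at h0
  simp only [map_zero, zsmul_eq_mul, zero_eq_mul, Int.cast_eq_zero] at h0
  exact h0.elim hd hi

end Primes

/-! ### Irreducibility, Schur's lemma and the eigenvalues -/

section Main

variable {n : ℕ} {A B : Matrix (Fin n) (Fin n) ℤ} {T : Matrix.GeneralLinearGroup (Fin n) ℚ}

/-- The conjugate `T⁻¹ B T`. -/
def pullback (B : Matrix (Fin n) (Fin n) ℤ) (T : Matrix.GeneralLinearGroup (Fin n) ℚ) :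
    Matrix (Fin n) (Fin n) ℚ :=
  ((T⁻¹ : Matrix.GeneralLinearGroup (Fin n) ℚ) : Matrix (Fin n) (Fin n) ℚ) * toRat B *
    (T : Matrix (Fin n) (Fin n) ℚ)

lemma mul_pullback :
    (T : Matrix (Fin n) (Fin n) ℚ) * pullback B T = toRat B * (T : Matrix (Fin n) (Fin n) ℚ) := by
  rw [pullback, ← Matrix.mul_assoc, ← Matrix.mul_assoc, GL_val_mul_inv, Matrix.one_mul]

lemma charpoly_pullback : (pullback B T).charpoly = B.charpoly.map (Int.castRingHom ℚ) := by
  rw [← Matrix.charpoly_map, pullback, Matrix.coe_units_inv]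
  exact Matrix.charpoly_units_conj' T (toRat B)

/-- An irreducible isomorphism admits no common invariant subspace. -/
lemma eq_bot_or_eq_top_of_isIrreducibleIso (hA : A.det ≠ 0) (hB : B.det ≠ 0)
    (hT : IsIrreducibleIso A B T) (V : Submodule ℚ (Fin n → ℚ))
    (hV : ∀ M ∈ ({toRat A, pullback B T} : Set (Matrix (Fin n) (Fin n) ℚ)), ∀ x ∈ V,
      Matrix.mulVec M x ∈ V) : V = ⊥ ∨ V = ⊤ := by
  by_contra! h
  exact hT.2 (isReducible_of_invariant hA hB hT.1 h.1 h.2 (hV _ (Or.inl rfl)) (hV _ (Or.inr rfl)))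

/-- For `T⁻¹BT`: `T` carries the contracted space of `A` into that of `B`, which `B` preserves, and
`T⁻¹` carries it back. -/
lemma isInvariant_contracted {L : Type*} [Field L] [Algebra ℚ L] (v : Valuation L NNReal)
    (hA : A.det ≠ 0) (hB : B.det ≠ 0) (hT : IsIso A B T) :
    IsInvariant ({toRat A, pullback B T} : Set (Matrix (Fin n) (Fin n) ℚ)) (contracted v A) := by
  have hmap : ∀ M : Matrix (Fin n) (Fin n) ℤ, (toRat M).map (algebraMap ℚ L) = toField L M :=
    fun M => by
      ext
      simp
  rintro M (rfl | rfl) x hx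
  · rw [hmap]
    exact toField_mulVec_mem_contracted v hx
  · rw [pullback, Matrix.map_mul, Matrix.map_mul, ← Matrix.mulVec_mulVec, ← Matrix.mulVec_mulVec,
      hmap]
    exact mulVec_iso_mem_contracted v hB hA (isIso_symm hT)
      (toField_mulVec_mem_contracted v (mulVec_iso_mem_contracted v hA hB hT hx))

/-- If two matrices commute and have no common invariant subspace, polynomials in either are zero
or invertible. -/
lemma aeval_eq_zero_or_isUnit {M N : Matrix (Fin n) (Fin n) ℚ} (hMN : M * N = N * M)
    (hirr : ∀ V : Submodule ℚ (Fin n → ℚ), (∀ P ∈ ({M, N} : Set (Matrix (Fin n) (Fin n) ℚ)),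
      ∀ x ∈ V, Matrix.mulVec P x ∈ V) → V = ⊥ ∨ V = ⊤) {P : Matrix (Fin n) (Fin n) ℚ}
    (hP : P ∈ ({M, N} : Set (Matrix (Fin n) (Fin n) ℚ))) (f : ℚ[X]) :
    aeval P f = 0 ∨ IsUnit (aeval P f) := by
  have hcomm : ∀ Q ∈ ({M, N} : Set (Matrix (Fin n) (Fin n) ℚ)), Commute (aeval P f) Q := by
    have key : ∀ Q ∈ ({M, N} : Set (Matrix (Fin n) (Fin n) ℚ)), Commute P Q := by
      rcases hP with rfl | rfl <;> rintro Q (rfl | rfl)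
      exacts [Commute.refl _, hMN, hMN.symm, Commute.refl _]
    intro Q hQ
    have hmem : aeval P f ∈ Algebra.adjoin ℚ {P} := aeval_mem_adjoin_singleton ℚ P
    refine Algebra.adjoin_induction (p := fun x _ => Commute x Q) ?_ ?_ ?_ ?_ hmem
    · rintro x rfl
      exact key Q hQ
    · exact fun r => Algebra.commutes r Q
    · exact fun x y _ _ hx hy => hx.add_left hy
    · exact fun x y _ _ hx hy => hx.mul_left hy
  -- Schur's lemma: the kernel of a matrix commuting with both is a common invariant subspace.
  rcases hirr (LinearMap.ker (Matrix.mulVecLin (aeval P f))) (fun Q hQ x hx => by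
    rw [LinearMap.mem_ker, Matrix.mulVecLin_apply] at hx ⊢
    rw [Matrix.mulVec_mulVec, (hcomm Q hQ).eq, ← Matrix.mulVec_mulVec, hx, Matrix.mulVec_zero])
    with h | h
  · right
    rw [← Matrix.mulVec_injective_iff_isUnit]
    exact LinearMap.ker_eq_bot.1 h
  · left
    apply Matrix.mulVec_injective
    ext x : 1
    rw [← Matrix.mulVecLin_apply, LinearMap.ker_eq_top.1 h]
    simp

/-- The empty determinant is `1`, which has no prime divisor. -/
lemma pos_of_mem_P' {p : ℕ} (hp : p ∈ P' A) : 0 < n := by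
  rcases Nat.eq_zero_or_pos n with rfl | h
  · have h1 := hp.1.2
    rw [Matrix.det_isEmpty] at h1
    exact absurd (Int.natCast_dvd_natCast.1 (by exact_mod_cast h1)) hp.1.1.not_dvd_one
  · exact h

lemma separable_map_charpoly (h : Irreducible A.charpoly) (F : Type*) [Field F] [CharZero F] :
    (toField F A).charpoly.Separable := by
  have hirr := (A.charpoly_monic.irreducible_iff_irreducible_map_fraction_map (K := ℚ)).1 h
  have := hirr.separable.map (f := Rat.castHom F)
  rw [Polynomial.map_map] at this
  rw [Matrix.charpoly_map]
  convert! this using 2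
  exact RingHom.ext_int _ _

lemma finrank_adjoin_of_isRoot (h : Irreducible A.charpoly) {c : QBar}
    (hc : (A.charpoly.map (Int.castRingHom QBar)).IsRoot c) :
    Module.finrank ℚ (IntermediateField.adjoin ℚ {c}) = n := by
  have hirr := (A.charpoly_monic.irreducible_iff_irreducible_map_fraction_map (K := ℚ)).1 h
  have hroot : aeval c (A.charpoly.map (algebraMap ℤ ℚ)) = 0 := by
    rw [aeval_map_algebraMap, aeval_def, ← eval_map]
    exact hc
  rw [IntermediateField.adjoin.finrank (Algebra.IsIntegral.isIntegral c),
    ← minpoly.eq_of_irreducible_of_monic hirr hroot (A.charpoly_monic.map _),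
    A.charpoly_monic.natDegree_map, Matrix.charpoly_natDegree_eq_dim, Fintype.card_fin]

lemma hasEigenvalue_toEnd_iff {c : QBar} :
    (toEnd A).HasEigenvalue c ↔ (A.charpoly.map (Int.castRingHom QBar)).IsRoot c := by
  rw [Module.End.hasEigenvalue_iff_isRoot_charpoly, toEnd, Matrix.charpoly_toLin',
    Matrix.charpoly_map]

/-- A root of the characteristic polynomial in a subfield of `Q̄` is an integral eigenvalue. -/
lemma exists_ringOfIntegers_of_isRoot {K : IntermediateField ℚ QBar} {c : K}
    (hc : (A.charpoly.map (Int.castRingHom K)).IsRoot c) :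
    ∃ l : NumberField.RingOfIntegers K, (l : K) = c ∧ (toEnd A).HasEigenvalue ((l : K) : QBar) := by
  have hint : IsIntegral ℤ c := ⟨A.charpoly, A.charpoly_monic, by rwa [IsRoot, eval_map] at hc⟩
  refine ⟨⟨c, hint⟩, rfl, hasEigenvalue_toEnd_iff.2 ?_⟩
  have := hc.map (f := (algebraMap K QBar))
  rw [Polynomial.map_map] at this
  convert! this using 2

/-- Matched eigenvalues generate the same field and have the same primes. -/
lemma exists_eigenvalues (hn : 0 < n) (hA : A.det ≠ 0) (hB : B.det ≠ 0) (hT : IsIso A B T)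
    (hcomm : toRat A * pullback B T = pullback B T * toRat A) (hirrA : Irreducible A.charpoly)
    (hirrB : Irreducible B.charpoly) :
    ∃ (K : IntermediateField ℚ QBar) (l m : NumberField.RingOfIntegers K),
      (toEnd A).HasEigenvalue ((l : K) : QBar) ∧ (toEnd B).HasEigenvalue ((m : K) : QBar) ∧
      K = IntermediateField.adjoin ℚ {((l : K) : QBar)} ∧
      K = IntermediateField.adjoin ℚ {((m : K) : QBar)} ∧ SamePrimeIdealDivisors l m := by
  obtain ⟨c, hc⟩ : ∃ c, (A.charpoly.map (Int.castRingHom QBar)).IsRoot c := by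
    refine IsAlgClosed.exists_root _ ?_
    rw [A.charpoly_monic.degree_map, Matrix.charpoly_degree_eq_dim, Fintype.card_fin]
    exact_mod_cast hn.ne'
  let K : IntermediateField ℚ QBar := IntermediateField.adjoin ℚ {c}
  have hfin : FiniteDimensional ℚ K :=
    IntermediateField.adjoin.finiteDimensional (Algebra.IsIntegral.isIntegral c)
  have hNF : NumberField K := { to_charZero := inferInstance, to_finiteDimensional := hfin }
  let a : K := ⟨c, IntermediateField.mem_adjoin_simple_self ℚ c⟩
  have ha : (A.charpoly.map (Int.castRingHom K)).IsRoot a := by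
    refine IsRoot.of_map (f := algebraMap K QBar) ?_ (algebraMap K QBar).injective
    rw [Polynomial.map_map]
    convert! hc using 2
  -- Eigenvectors of the transpose are left eigenvectors, that is, functionals that can be evaluated
  -- on `G_A` and `G_B`.
  obtain ⟨w, hw0, hw⟩ := exists_mulVec_eq_smul_of_isRoot
    (M := (toField K A).transpose) (a := a) (by rwa [Matrix.charpoly_transpose, Matrix.charpoly_map])
  let ρ : Matrix (Fin n) (Fin n) ℚ →+* Matrix (Fin n) (Fin n) K := (Rat.castHom K).mapMatrix
  have hρ : ∀ M : Matrix (Fin n) (Fin n) ℤ, ρ (toRat M) = toField K M := fun M => by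
    ext : 2
    simp [ρ]
  obtain ⟨b, hb⟩ := exists_mulVec_eq_smul_of_commute (N := (ρ (pullback B T)).transpose)
    (by rw [Matrix.charpoly_transpose]; exact separable_map_charpoly hirrA K)
    (by rw [← Matrix.transpose_mul, ← Matrix.transpose_mul, ← hρ, ← map_mul, ← map_mul, hcomm])
    hw0 hw
  rw [Matrix.mulVec_transpose] at hw hb
  let w' := Matrix.vecMul w (ρ ((T⁻¹ : Matrix.GeneralLinearGroup (Fin n) ℚ) :
    Matrix (Fin n) (Fin n) ℚ))
  have hww' : w = Matrix.vecMul w' (ρ (T : Matrix (Fin n) (Fin n) ℚ)) := by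
    rw [Matrix.vecMul_vecMul, ← map_mul, GL_val_inv_mul, map_one, Matrix.vecMul_one]
  have hw'0 : w' ≠ 0 := fun h => hw0 (by rw [hww', h, Matrix.zero_vecMul])
  have hw'B : Matrix.vecMul w' (toField K B) = b • w' := by
    rw [← Matrix.smul_vecMul, ← hb, Matrix.vecMul_vecMul, Matrix.vecMul_vecMul, ← hρ, ← map_mul,
      ← map_mul, pullback, Matrix.mul_assoc _ (T : Matrix (Fin n) (Fin n) ℚ), GL_val_mul_inv,
      Matrix.mul_one]
  have hbroot : (B.charpoly.map (Int.castRingHom K)).IsRoot b := by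
    have := isRoot_charpoly_of_mulVec_eq_smul (M := (toField K B).transpose) hw'0
      (by rw [Matrix.mulVec_transpose]; exact hw'B)
    rwa [Matrix.charpoly_transpose, Matrix.charpoly_map] at this
  obtain ⟨l, hl, hlA⟩ := exists_ringOfIntegers_of_isRoot ha
  obtain ⟨m, hm, hmB⟩ := exists_ringOfIntegers_of_isRoot hbroot
  refine ⟨K, l, m, hlA, hmB, ?_, ?_, ?_⟩
  · rw [hl]
  -- The eigenvalue of `B` lies in `K` by construction, and both fields have degree `n` because both
  -- characteristic polynomials are irreducible.
  · have hle : IntermediateField.adjoin ℚ {((m : K) : QBar)} ≤ K := by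
      rw [IntermediateField.adjoin_simple_le_iff]
      exact (m : K).2
    refine (IntermediateField.eq_of_le_of_finrank_eq hle ?_).symm
    rw [finrank_adjoin_of_isRoot hirrA hc,
      finrank_adjoin_of_isRoot hirrB (hasEigenvalue_toEnd_iff.1 hmB)]
  · rw [← hl] at hw
    rw [← hm] at hw'B
    intro I hI _
    rw [Ideal.dvd_span_singleton, Ideal.dvd_span_singleton]
    exact ⟨mem_prime_of_mem_prime hB hA (isIso_symm hT) hw0 rfl hw'B hw hI,
      mem_prime_of_mem_prime hA hB hT hw'0 hww' hw hw'B hI⟩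

end Main

end ToroidalSolenoid

open ToroidalSolenoid in
theorem proposition5p6 (n : ℕ) (A B : Matrix (Fin n) (Fin n) ℤ)
    (hA : A.det ≠ 0) (hB : B.det ≠ 0)
    (hp : ∃ p ∈ ToroidalSolenoid.P' A, Nat.gcd n (ToroidalSolenoid.t p A) = 1)
    (T : Matrix.GeneralLinearGroup (Fin n) ℚ)
    (hT : ToroidalSolenoid.IsIrreducibleIso A B T) :
    Irreducible A.charpoly ∧ Irreducible B.charpoly ∧
    (∃ (K : IntermediateField ℚ ToroidalSolenoid.QBar)
        (l m : NumberField.RingOfIntegers K),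
      (ToroidalSolenoid.toEnd A).HasEigenvalue ((l : K) : ToroidalSolenoid.QBar) ∧
      (ToroidalSolenoid.toEnd B).HasEigenvalue ((m : K) : ToroidalSolenoid.QBar) ∧
      K = IntermediateField.adjoin ℚ {((l : K) : ToroidalSolenoid.QBar)} ∧
      K = IntermediateField.adjoin ℚ {((m : K) : ToroidalSolenoid.QBar)} ∧
      ToroidalSolenoid.SamePrimeIdealDivisors l m) ∧
    (∀ (u : Fin n → ToroidalSolenoid.QBar),
      (∃ a, (ToroidalSolenoid.toEnd A).HasEigenvector a u) →
      ∃ b, (ToroidalSolenoid.toEnd B).HasEigenvector b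
        (Matrix.mulVec ((T : Matrix (Fin n) (Fin n) ℚ).map
          (algebraMap ℚ ToroidalSolenoid.QBar)) u)) := by
  obtain ⟨p, hpA, hcop⟩ := hp
  have hn := pos_of_mem_P' hpA
  have hpp : p.Prime := hpA.1.1
  obtain ⟨v, hv⟩ := exists_valuation_lt_one hpp
  have hclosure : IsAlgClosure ℚ QBar := ⟨inferInstance, inferInstance⟩
  have hnormal : Normal ℚ QBar := IsAlgClosure.normal ℚ QBar
  have hgal : IsGalois ℚ QBar := { to_isSeparable := inferInstance, to_normal := inferInstance }
  have hirr := eq_bot_or_eq_top_of_isIrreducibleIso hA hB hT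
  have hcomm : toRat A * pullback B T = pullback B T * toRat A :=
    commute_of_coprime_finrank hn hirr (isInvariant_contracted v hA hB hT.1)
      (by rwa [finrank_contracted v hpp hv]) (Or.inl rfl) (Or.inr rfl)
  have hirrA : Irreducible A.charpoly :=
    irreducible_of_aeval_eq_zero_or_isUnit hn A.charpoly_monic (Matrix.charpoly_map _ _)
      (aeval_eq_zero_or_isUnit hcomm hirr (Or.inl rfl)) hpp hcop
  have hirrB : Irreducible B.charpoly :=
    irreducible_of_aeval_eq_zero_or_isUnit hn B.charpoly_monic charpoly_pullback
      (aeval_eq_zero_or_isUnit hcomm hirr (Or.inr rfl)) hpp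
      (by rwa [t_eq_of_isIso hA hB hT.1 hpp] at hcop)
  refine ⟨hirrA, hirrB, exists_eigenvalues hn hA hB hT.1 hcomm hirrA hirrB, ?_⟩
  rintro u ⟨a, hu⟩
  let ρ : Matrix (Fin n) (Fin n) ℚ →+* Matrix (Fin n) (Fin n) QBar :=
    (algebraMap ℚ QBar).mapMatrix
  have hρ : ∀ M : Matrix (Fin n) (Fin n) ℤ, ρ (toRat M) = toField QBar M := fun M => by
    ext
    simp [ρ]
  have hAu : Matrix.mulVec (toField QBar A) u = a • u := by
    rw [← hu.apply_eq_smul, toEnd, Matrix.toLin'_apply]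
  -- From `T⁻¹BT u = b u` follows `B (T u) = b (T u)`.
  obtain ⟨b, hb⟩ := exists_mulVec_eq_smul_of_commute (M := toField QBar A) (N := ρ (pullback B T))
    (separable_map_charpoly hirrA QBar)
    (by rw [← hρ, ← map_mul, ← map_mul, hcomm]) hu.2 hAu
  refine ⟨b, hasEigenvector_matrixEnd (fun h0 => hu.2 ?_) ?_⟩
  · rw [← Matrix.one_mulVec u, ← map_GL_inv_mul T, ← Matrix.mulVec_mulVec, h0, Matrix.mulVec_zero]
  · change Matrix.mulVec (toField QBar B) (Matrix.mulVec (ρ (T : Matrix (Fin n) (Fin n) ℚ)) u) =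
      b • Matrix.mulVec (ρ (T : Matrix (Fin n) (Fin n) ℚ)) u
    rw [← Matrix.mulVec_smul, ← hb, Matrix.mulVec_mulVec, Matrix.mulVec_mulVec, ← hρ, ← map_mul,
      ← map_mul, mul_pullback]
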